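/- Let $\mathrm{Pol}(U_N^+)$ be the universal unital $*$-algebra generated by $u_{ij}$ ($1\le i,j\le N$) such that $U=(u_{ij})$ and $\overline U=(u_{ij}^*)$ are unitary, and let $\mathrm{Pol}(H_N^{\infty+})$ be its quotient by the relations that every $u_{ij}$ is a normal partial isometry and that the projections $u_{ij}u_{ij}^*$ are pairwise orthogonal along each row and each column. Both carry the coproduct $\Delta(u_{ij})=\sum_k u_{ik}\otimes u_{kj}$ and the counit $\varepsilon(u_{ij})=\delta_{ij}$. Let $\mathrm{Pol}(\mathbb T)=\mathbb C[z,z^{-1}]$ with $z^*=z^{-1}$, $\Delta(z)=z\otimes z$, $\varepsilon(z)=1$, and let $\pi$ be the surjective $*$-homomorphism $u_{ij}\mapsto\delta_{ij}z$ onto $\mathrm{Pol}(\mathbb T)$, which makes $\mathbb T$ (the scalar matrices) a quantum subgroup. A linear functional $\phi$ is a generating functional if $\phi(1)=0$, $\phi(b^*)=\overline{\phi(b)}$ for all $b$, and $\phi(b^*b)\ge 0$ whenever $\varepsilon(b)=0$; it is Gaussian if moreover it vanishes on $(\ker\varepsilon)^3$; it is central if $(\phi\otimes\psi)\circ\Delta=(\psi\otimes\phi)\circ\Delta$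 for every linear functional $\psi$. Let $\mathbb G=U_N^+$ with $N\ge 2$, or $\mathbb G=H_N^{\infty+}$ with $N\ge 3$. A linear functional $\phi$ on $\mathrm{Pol}(\mathbb G)$ is a central Gaussian generating functional if and only if $\phi=\psi\circ\pi$ for some Gaussian generating functional $\psi$ on $\mathrm{Pol}(\mathbb T)$; equivalently, if and only if $\phi=\psi_{\nu,\mu}\circ\pi$ for some $\nu\in\mathbb R$ and $\mu\ge0$, where $\psi_{\nu,\mu}(z^n)=i\nu n-\tfrac{\mu}{2}n^2$ for $n\in\mathbb Z$, and the pair $(\nu,\mu)$ is then unique. The parameters are the drift and the variance of a Brownian motion on $\mathbb T$: for all $t\ge0$ and $n\in\mathbb Z$, $e^{t\psi_{\nu,\mu}(z^n)}=\mathbb E\big[e^{inX_t}\big]$ with $X_t$ normally distributed with mean $\nu t$ and variance $\mu t$. -/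

import Mathlib

open scoped TensorProduct LaurentPolynomial NNReal ComplexOrder

noncomputable section

namespace QG

/-! ### Functionals on `*`-bialgebras -/

section Functionals

variable {B : Type*} [Ring B] [Bialgebra ℂ B]

variable (B) in
/-- `K n` is the linear span of the products of `n` elements of the kernel of the counit. -/
def K (n : ℕ) : Submodule ℂ B := LinearMap.ker (Coalgebra.counit (R := ℂ) (A := B)) ^ n

/-- The convolution `(φ ⊗ ψ) ∘ Δ` of two functionals. -/
def conv (φ ψ : B →ₗ[ℂ] ℂ) : B →ₗ[ℂ] ℂ :=
  LinearMap.mul' ℂ ℂ ∘ₗ TensorProduct.map φ ψ ∘ₗ Coalgebra.comul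

/-- A functional is central if it commutes with every functional under convolution. -/
def IsCentral (φ : B →ₗ[ℂ] ℂ) : Prop := ∀ ψ : B →ₗ[ℂ] ℂ, conv φ ψ = conv ψ φ

/-- A generating functional: normalized, hermitian, conditionally positive. -/
structure IsGenerating [StarRing B] (φ : B →ₗ[ℂ] ℂ) : Prop where
  map_one : φ 1 = 0
  map_star : ∀ b, φ (star b) = star (φ b)
  nonneg : ∀ b, Coalgebra.counit (R := ℂ) b = 0 → 0 ≤ φ (star b * b)

/-- A Gaussian generating functional: a generating functional that vanishes on `K 3`. -/
structure IsGaussian [StarRing B] (φ : B →ₗ[ℂ] ℂ) : Prop where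
  generating : IsGenerating φ
  map_K_three : ∀ b ∈ K B 3, φ b = 0

end Functionals

/-! ### The circle -/

section Circle

/-- The Hopf algebra `Pol(𝕋) = ℂ[z, z⁻¹]`; the generator `z` is `T 1` and `Δ(zⁿ) = zⁿ ⊗ zⁿ`. -/
abbrev PolT : Type := ℂ[T;T⁻¹]

/-- The conjugate-linear involution of `Pol(𝕋)` with `(zⁿ)* = z⁻ⁿ`. -/
instance : StarRing PolT where
  star f := LaurentPolynomial.invert (AddMonoidAlgebra.mapRingHom ℤ (starRingEnd ℂ) f)
  star_involutive f := by
    ext n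
    simp
  star_mul f g := by
    rw [map_mul, map_mul, mul_comm]
  star_add f g := by
    rw [map_add, map_add]

theorem star_T (n : ℤ) : star (LaurentPolynomial.T n : PolT) = LaurentPolynomial.T (-n) := by
  change LaurentPolynomial.invert (AddMonoidAlgebra.mapRingHom ℤ (starRingEnd ℂ) _) = _
  rw [← LaurentPolynomial.invert_T]
  congr 1
  simp [LaurentPolynomial.T, -LaurentPolynomial.single_eq_C_mul_T]

instance : StarModule ℂ PolT where
  star_smul c f := by
    change LaurentPolynomial.invert (AddMonoidAlgebra.mapRingHom ℤ (starRingEnd ℂ) _) =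
      _ • LaurentPolynomial.invert (AddMonoidAlgebra.mapRingHom ℤ (starRingEnd ℂ) _)
    ext n
    simp

/-- The functional on `Pol(𝕋)` with `zⁿ ↦ i ν n - μ n² / 2`. -/
def brownian (ν : ℝ) (μ : ℝ≥0) : PolT →ₗ[ℂ] ℂ where
  toFun f := f.coeff.sum fun n a => a * (Complex.I * ν * n - μ * n ^ 2 / 2)
  map_add' f g := by
    rw [AddMonoidAlgebra.coeff_add]
    exact Finsupp.sum_add_index' (by simp) (by intros; ring)
  map_smul' c f := by
    rw [AddMonoidAlgebra.coeff_smul, Finsupp.sum_smul_index (by simp)]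
    simp [Finset.mul_sum, Finsupp.sum, mul_assoc]

theorem brownian_T (ν : ℝ) (μ : ℝ≥0) (n : ℤ) :
    brownian ν μ (LaurentPolynomial.T n) = Complex.I * ν * n - μ * n ^ 2 / 2 := by
  simp [brownian, LaurentPolynomial.T, -LaurentPolynomial.single_eq_C_mul_T]

end Circle

/-! ### The free unitary and the free infinite hyperoctahedral quantum groups -/

section Relations

variable {N : ℕ} {B : Type*} [Ring B]

/-- For a matrix `x` over a `*`-algebra with entrywise adjoint `y`: both `x` and `y` are unitary
(the adjoint matrix of `x` is `yᵀ`, that of `y` is `xᵀ`). -/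
structure IsBiunitary (x y : Matrix (Fin N) (Fin N) B) : Prop where
  mul_adj : x * y.transpose = 1
  adj_mul : y.transpose * x = 1
  conj_mul_adj : y * x.transpose = 1
  conj_adj_mul : x.transpose * y = 1

/-- For a matrix `x` over a `*`-algebra with entrywise adjoint `y`: every entry is a normal partial
isometry, and the range projections in each row and each column are pairwise orthogonal.
(In a `C*`-algebra, for a biunitary matrix, the orthogonality is automatic, since
the projections in a row or a column sum to `1`.) -/
structure IsReflection (x y : Matrix (Fin N) (Fin N) B) : Prop where
  normal : ∀ i j, x i j * y i j = y i j * x i j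
  isometry : ∀ i j, x i j * y i j * x i j = x i j
  isometry_adj : ∀ i j, y i j * x i j * y i j = y i j
  row : ∀ i j k, j ≠ k → x i j * y i j * (x i k * y i k) = 0
  col : ∀ i j k, i ≠ j → x i k * y i k * (x j k * y j k) = 0

end Relations

/-- The two families of quantum groups: `U` for `U_N^+`, `H` for `H_N^{∞+}`. -/
inductive Family
  | U
  | H

/-- The letters `u_ij` and `u_ij*`. -/
inductive Letter (N : ℕ)
  | u (i j : Fin N)
  | uStar (i j : Fin N)

/-- The free algebra on the letters `u_ij`, `u_ij*`. -/
abbrev Free (N : ℕ) : Type := FreeAlgebra ℂ (Letter N)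

/-- The matrix of the letters `u_ij`. -/
def freeU (N : ℕ) : Matrix (Fin N) (Fin N) (Free N) :=
  Matrix.of fun i j => FreeAlgebra.ι ℂ (Letter.u i j)

/-- The matrix of the letters `u_ij*`. -/
def freeV (N : ℕ) : Matrix (Fin N) (Fin N) (Free N) :=
  Matrix.of fun i j => FreeAlgebra.ι ℂ (Letter.uStar i j)

/-- The relations saying that `U = (u_ij)` and `(u_ij*)` are unitary. -/
inductive UnitaryRel (N : ℕ) : Free N → Free N → Prop
  | mul_adj (i j : Fin N) :
      UnitaryRel N ((freeU N * (freeV N).transpose) i j) ((1 : Matrix _ _ (Free N)) i j)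
  | adj_mul (i j : Fin N) :
      UnitaryRel N (((freeV N).transpose * freeU N) i j) ((1 : Matrix _ _ (Free N)) i j)
  | conj_mul_adj (i j : Fin N) :
      UnitaryRel N ((freeV N * (freeU N).transpose) i j) ((1 : Matrix _ _ (Free N)) i j)
  | conj_adj_mul (i j : Fin N) :
      UnitaryRel N (((freeU N).transpose * freeV N) i j) ((1 : Matrix _ _ (Free N)) i j)

/-- The relations saying that the `u_ij` are normal partial isometries whose range projections are
orthogonal along rows and columns. -/
inductive ReflectionRel (N : ℕ) : Free N → Free N → Prop
  | normal (i j : Fin N) :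
      ReflectionRel N (freeU N i j * freeV N i j) (freeV N i j * freeU N i j)
  | isometry (i j : Fin N) :
      ReflectionRel N (freeU N i j * freeV N i j * freeU N i j) (freeU N i j)
  | isometry_adj (i j : Fin N) :
      ReflectionRel N (freeV N i j * freeU N i j * freeV N i j) (freeV N i j)
  | row (i j k : Fin N) (h : j ≠ k) :
      ReflectionRel N (freeU N i j * freeV N i j * (freeU N i k * freeV N i k)) 0
  | col (i j k : Fin N) (h : i ≠ j) :
      ReflectionRel N (freeU N i k * freeV N i k * (freeU N j k * freeV N j k)) 0

/-- The defining relations of the two families. -/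
def Rel (G : Family) (N : ℕ) (a b : Free N) : Prop :=
  match G with
  | .U => UnitaryRel N a b
  | .H => UnitaryRel N a b ∨ ReflectionRel N a b

/-- The algebra `Pol(U_N^+)` or `Pol(H_N^{∞+})`. -/
def Pol (G : Family) (N : ℕ) : Type := RingQuot (Rel G N)

instance (G : Family) (N : ℕ) : Ring (Pol G N) := inferInstanceAs (Ring (RingQuot (Rel G N)))

instance (G : Family) (N : ℕ) : Algebra ℂ (Pol G N) :=
  inferInstanceAs (Algebra ℂ (RingQuot (Rel G N)))

/-- `Pol(U_N^+)`: the universal unital `*`-algebra generated by the entries of a matrix `U` such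
that `U` and its entrywise adjoint are unitary. -/
abbrev PolU (N : ℕ) : Type := Pol .U N

/-- `Pol(H_N^{∞+})`: the universal unital `*`-algebra generated by the entries of a matrix `U`
such that `U` and its entrywise adjoint are unitary and all entries are normal partial isometries
(with orthogonal range projections along rows and columns). -/
abbrev PolH (N : ℕ) : Type := Pol .H N

namespace Pol

variable {G : Family} {N : ℕ}

/-- The quotient map. -/
def mk (G : Family) (N : ℕ) : Free N →ₐ[ℂ] Pol G N := RingQuot.mkAlgHom ℂ (Rel G N)

/-- The generator `u_ij`. -/
def u (G : Family) (N : ℕ) : Matrix (Fin N) (Fin N) (Pol G N) := (freeU N).map (mk G N)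

/-- The generator `u_ij*`. -/
def v (G : Family) (N : ℕ) : Matrix (Fin N) (Fin N) (Pol G N) := (freeV N).map (mk G N)

/-- A pair of matrices satisfies the defining relations. -/
def Sat (G : Family) {B : Type*} [Ring B] (x y : Matrix (Fin N) (Fin N) B) : Prop :=
  IsBiunitary x y ∧ (G = .H → IsReflection x y)

theorem mk_rel {a b : Free N} (h : Rel G N a b) : mk G N a = mk G N b :=
  RingQuot.mkAlgHom_rel ℂ h

theorem rel_of_unitaryRel {a b : Free N} (h : UnitaryRel N a b) : Rel G N a b := by
  cases G
  · exact h
  · exact Or.inl h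

/-- The generators satisfy the defining relations. -/
theorem sat (G : Family) (N : ℕ) : Sat G (u G N) (v G N) := by
  have key : ∀ {x y : Matrix (Fin N) (Fin N) (Free N)},
      (∀ i j, UnitaryRel N ((x * y) i j) ((1 : Matrix (Fin N) (Fin N) (Free N)) i j)) →
      x.map (mk G N) * y.map (mk G N) = 1 := by
    intro x y h
    rw [← Matrix.map_mul, ← Matrix.map_one (mk G N) (map_zero _) (map_one _)]
    ext i j
    exact mk_rel (rel_of_unitaryRel (h i j))
  refine ⟨⟨key UnitaryRel.mul_adj, key UnitaryRel.adj_mul, key UnitaryRel.conj_mul_adj,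
    key UnitaryRel.conj_adj_mul⟩, ?_⟩
  rintro rfl
  refine ⟨fun i j => ?_, fun i j => ?_, fun i j => ?_, fun i j k h => ?_, fun i j k h => ?_⟩
  · simpa [u, v] using mk_rel (G := .H) (Or.inr (ReflectionRel.normal i j))
  · simpa [u, v] using mk_rel (G := .H) (Or.inr (ReflectionRel.isometry i j))
  · simpa [u, v] using mk_rel (G := .H) (Or.inr (ReflectionRel.isometry_adj i j))
  · simpa [u, v] using mk_rel (G := .H) (Or.inr (ReflectionRel.row i j k h))
  · simpa [u, v] using mk_rel (G := .H) (Or.inr (ReflectionRel.col i j k h))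

section Lift

variable {B : Type*} [Ring B] [Algebra ℂ B]

/-- The homomorphism of the free algebra given by two matrices. -/
def freeLift (x y : Matrix (Fin N) (Fin N) B) : Free N →ₐ[ℂ] B :=
  FreeAlgebra.lift ℂ fun l => match l with
    | .u i j => x i j
    | .uStar i j => y i j

theorem freeLift_u (x y : Matrix (Fin N) (Fin N) B) (i j : Fin N) :
    freeLift x y (freeU N i j) = x i j := by simp [freeLift, freeU]

theorem freeLift_v (x y : Matrix (Fin N) (Fin N) B) (i j : Fin N) :
    freeLift x y (freeV N i j) = y i j := by simp [freeLift, freeV]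

theorem freeLift_rel {x y : Matrix (Fin N) (Fin N) B} (h : Sat G x y) ⦃a b : Free N⦄
    (r : Rel G N a b) : freeLift x y a = freeLift x y b := by
  have hx : (freeU N).map (freeLift x y) = x := by
    ext i j
    exact freeLift_u x y i j
  have hy : (freeV N).map (freeLift x y) = y := by
    ext i j
    exact freeLift_v x y i j
  have key : ∀ {p q : Matrix (Fin N) (Fin N) (Free N)} (i j : Fin N),
      p.map (freeLift x y) * q.map (freeLift x y) = 1 →
      freeLift x y ((p * q) i j) =
        freeLift x y ((1 : Matrix (Fin N) (Fin N) (Free N)) i j) := by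
    intro p q i j h
    rw [← Matrix.map_mul, ← Matrix.map_one (freeLift x y) (map_zero _) (map_one _)] at h
    exact congrFun (congrFun h i) j
  have hU : UnitaryRel N a b → freeLift x y a = freeLift x y b := by
    intro r
    cases r with
    | mul_adj i j => exact key i j (by rw [Matrix.transpose_map, hx, hy]; exact h.1.mul_adj)
    | adj_mul i j => exact key i j (by rw [Matrix.transpose_map, hx, hy]; exact h.1.adj_mul)
    | conj_mul_adj i j =>
      exact key i j (by rw [Matrix.transpose_map, hx, hy]; exact h.1.conj_mul_adj)
    | conj_adj_mul i j =>
      exact key i j (by rw [Matrix.transpose_map, hx, hy]; exact h.1.conj_adj_mul)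
  cases G with
  | U => exact hU r
  | H =>
    rcases r with r | r
    · exact hU r
    · have hR := h.2 rfl
      cases r with
      | normal i j => simpa [freeLift_u, freeLift_v] using hR.normal i j
      | isometry i j => simpa [freeLift_u, freeLift_v] using hR.isometry i j
      | isometry_adj i j => simpa [freeLift_u, freeLift_v] using hR.isometry_adj i j
      | row i j k hne => simpa [freeLift_u, freeLift_v] using hR.row i j k hne
      | col i j k hne => simpa [freeLift_u, freeLift_v] using hR.col i j k hne

/-- The universal property: two matrices satisfying the relations define a homomorphism. -/
def lift (x y : Matrix (Fin N) (Fin N) B) (h : Sat G x y) : Pol G N →ₐ[ℂ] B :=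
  RingQuot.liftAlgHom ℂ ⟨freeLift x y, freeLift_rel h⟩

@[simp]
theorem lift_u (x y : Matrix (Fin N) (Fin N) B) (h : Sat G x y) (i j : Fin N) :
    lift x y h (u G N i j) = x i j := by
  rw [← freeLift_u x y i j]
  exact RingQuot.liftAlgHom_mkAlgHom_apply ℂ (freeLift x y) (freeLift_rel h) _

@[simp]
theorem lift_v (x y : Matrix (Fin N) (Fin N) B) (h : Sat G x y) (i j : Fin N) :
    lift x y h (v G N i j) = y i j := by
  rw [← freeLift_v x y i j]
  exact RingQuot.liftAlgHom_mkAlgHom_apply ℂ (freeLift x y) (freeLift_rel h) _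

theorem hom_ext {f g : Pol G N →ₐ[ℂ] B} (hu : ∀ i j, f (u G N i j) = g (u G N i j))
    (hv : ∀ i j, f (v G N i j) = g (v G N i j)) : f = g := by
  refine RingQuot.ringQuot_ext' ℂ f g (FreeAlgebra.hom_ext ?_)
  funext l
  cases l with
  | u i j => exact hu i j
  | uStar i j => exact hv i j

end Lift

/-! #### The involution -/

/-- The opposite algebra with complex-conjugated scalars: conjugate-linear antihomomorphisms into
`B` are homomorphisms into `ConjOp B`. -/
def ConjOp (B : Type*) : Type _ := Bᵐᵒᵖ

instance (B : Type*) [Ring B] : Ring (ConjOp B) := inferInstanceAs (Ring Bᵐᵒᵖ)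

instance (B : Type*) [Ring B] [Algebra ℂ B] : Algebra ℂ (ConjOp B) :=
  RingHom.toAlgebra' ((algebraMap ℂ Bᵐᵒᵖ).comp (starRingEnd ℂ))
    fun c x => Algebra.commutes (A := Bᵐᵒᵖ) (starRingEnd ℂ c) x

/-- The identity map from `B` to `ConjOp B`. -/
def toOp {B : Type*} [Ring B] : B ≃+ ConjOp B := (MulOpposite.opAddEquiv : B ≃+ Bᵐᵒᵖ)

theorem toOp_mul {B : Type*} [Ring B] (a b : B) : toOp (a * b) = toOp b * toOp a := rfl

theorem toOp_one {B : Type*} [Ring B] : toOp (1 : B) = 1 := rfl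

theorem toOp_algebraMap {B : Type*} [Ring B] [Algebra ℂ B] (c : ℂ) :
    toOp (algebraMap ℂ B (starRingEnd ℂ c)) = algebraMap ℂ (ConjOp B) c := rfl

theorem sat_star (G : Family) (N : ℕ) :
    Sat G ((v G N).map toOp) ((u G N).map (toOp (B := Pol G N))) := by
  have key : ∀ {x y : Matrix (Fin N) (Fin N) (Pol G N)}, x * y = 1 →
      (y.transpose.map toOp) * (x.transpose.map (toOp (B := Pol G N))) = 1 := by
    intro x y h
    ext i j
    have h' := congrArg toOp (congrFun (congrFun h j) i)
    rw [Matrix.mul_apply, map_sum] at h'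
    rw [Matrix.mul_apply]
    simp only [Matrix.map_apply, Matrix.transpose_apply, ← toOp_mul]
    rw [h']
    by_cases hij : i = j
    · subst hij
      simp [toOp_one]
    · rw [Matrix.one_apply_ne (Ne.symm hij), Matrix.one_apply_ne hij, map_zero]
  obtain ⟨h, hR⟩ := sat G N
  refine ⟨⟨key h.mul_adj, key h.adj_mul, key h.conj_mul_adj, key h.conj_adj_mul⟩, ?_⟩
  intro hG
  have hR := hR hG
  refine ⟨fun i j => ?_, fun i j => ?_, fun i j => ?_, fun i j k hne => ?_, fun i j k hne => ?_⟩
  · simp only [Matrix.map_apply, ← toOp_mul, hR.normal]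
  · simp only [Matrix.map_apply, ← toOp_mul, ← mul_assoc, hR.isometry_adj]
  · simp only [Matrix.map_apply, ← toOp_mul, ← mul_assoc, hR.isometry]
  · simp only [Matrix.map_apply, ← toOp_mul, hR.row i k j (Ne.symm hne), map_zero]
  · simp only [Matrix.map_apply, ← toOp_mul, hR.col j i k (Ne.symm hne), map_zero]

/-- The conjugate-linear antihomomorphism that exchanges `u_ij` and `u_ij*`. -/
def starHom (G : Family) (N : ℕ) : Pol G N →ₐ[ℂ] ConjOp (Pol G N) :=
  lift _ _ (sat_star G N)

instance : Star (Pol G N) := ⟨fun a => toOp.symm (starHom G N a)⟩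

theorem toOp_star (a : Pol G N) : toOp (star a) = starHom G N a := toOp.apply_symm_apply _

theorem star_mul' (a b : Pol G N) : star (a * b) = star b * star a :=
  toOp.injective (by rw [toOp_mul, toOp_star, toOp_star, toOp_star, map_mul])

theorem star_add' (a b : Pol G N) : star (a + b) = star a + star b :=
  toOp.injective (by rw [map_add, toOp_star, toOp_star, toOp_star, map_add])

theorem star_algebraMap' (c : ℂ) :
    star (algebraMap ℂ (Pol G N) c) = algebraMap ℂ (Pol G N) (starRingEnd ℂ c) :=
  toOp.injective (by rw [toOp_star, AlgHom.commutes, toOp_algebraMap])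

theorem star_u (i j : Fin N) : star (u G N i j) = v G N i j :=
  toOp.injective (by rw [toOp_star, starHom, lift_u, Matrix.map_apply])

theorem star_v (i j : Fin N) : star (v G N i j) = u G N i j :=
  toOp.injective (by rw [toOp_star, starHom, lift_v, Matrix.map_apply])

/-- The involution of `Pol`: the conjugate-linear antiautomorphism with `(u_ij)* = u_ij*`. -/
instance : StarRing (Pol G N) where
  star_involutive a := by
    let f : Pol G N →ₐ[ℂ] Pol G N :=
      { toFun := fun a => star (star a)
        map_one' := by
          have h := star_algebraMap' (G := G) (N := N) 1
          simp only [map_one] at h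
          rw [h, h]
        map_mul' := fun a b => by rw [star_mul', star_mul']
        map_zero' := by
          have h := star_algebraMap' (G := G) (N := N) 0
          simp only [map_zero] at h
          rw [h, h]
        map_add' := fun a b => by rw [star_add', star_add']
        commutes' := fun c => by
          rw [star_algebraMap', star_algebraMap']
          simp }
    have hf : f = AlgHom.id ℂ _ := hom_ext
      (fun i j => show star (star (u G N i j)) = _ by rw [star_u, star_v]; rfl)
      (fun i j => show star (star (v G N i j)) = _ by rw [star_v, star_u]; rfl)
    exact congrArg (fun g : Pol G N →ₐ[ℂ] Pol G N => g a) hf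
  star_mul := star_mul'
  star_add := star_add'

instance : StarModule ℂ (Pol G N) where
  star_smul c a := by
    rw [Algebra.smul_def, star_mul', star_algebraMap', Algebra.smul_def, Algebra.commutes]
    rfl

/-! #### The coproduct and the counit -/

theorem sat_counit (G : Family) (N : ℕ) : Sat (N := N) G (B := ℂ) 1 1 := by
  refine ⟨⟨by simp, by simp, by simp, by simp⟩, fun _ => ?_⟩
  refine ⟨fun i j => ?_, fun i j => ?_, fun i j => ?_, fun i j k h => ?_, fun i j k h => ?_⟩
  · rfl
  · by_cases hij : i = j <;> simp [Matrix.one_apply, hij]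
  · by_cases hij : i = j <;> simp [Matrix.one_apply, hij]
  · by_cases hij : i = j
    · subst hij
      simp [h]
    · simp [Matrix.one_apply, hij]
  · by_cases hij : i = k
    · subst hij
      simp [Ne.symm h]
    · simp [Matrix.one_apply, hij]

/-- The counit: `ε(u_ij) = δ_ij`. -/
def counitHom (G : Family) (N : ℕ) : Pol G N →ₐ[ℂ] ℂ := lift 1 1 (sat_counit G N)

section Reflection

variable {B : Type*} [Ring B] {x y : Matrix (Fin N) (Fin N) B}

theorem _root_.QG.IsReflection.mul_proj (h : IsReflection x y) (i j : Fin N) :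
    x i j * (x i j * y i j) = x i j := by rw [h.normal, ← mul_assoc, h.isometry]

theorem _root_.QG.IsReflection.proj_mul_adj (h : IsReflection x y) (i j : Fin N) :
    x i j * y i j * y i j = y i j := by rw [h.normal, h.isometry_adj]

theorem _root_.QG.IsReflection.proj_sq (h : IsReflection x y) (i j : Fin N) :
    x i j * y i j * (x i j * y i j) = x i j * y i j := by rw [← mul_assoc, h.isometry]

theorem _root_.QG.IsReflection.row_mul_adj (h : IsReflection x y) (i : Fin N) {j k : Fin N} (hjk : j ≠ k) :
    x i j * y i k = 0 := by
  rw [← h.mul_proj i j, ← h.proj_mul_adj i k, mul_assoc, ← mul_assoc _ _ (y i k),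
    h.row i j k hjk, zero_mul, mul_zero]

theorem _root_.QG.IsReflection.row_adj_mul (h : IsReflection x y) (i : Fin N) {j k : Fin N} (hjk : j ≠ k) :
    y i j * x i k = 0 := by
  rw [← h.isometry_adj i j, ← h.isometry i k, mul_assoc (y i j), mul_assoc (y i j),
    ← mul_assoc _ _ (x i k), h.row i j k hjk, zero_mul, mul_zero]

end Reflection

section Coproduct

variable {B : Type*} [Ring B]

/-- Two pairs of matrices satisfying the relations, with entries that commute with one another,
have products satisfying the relations. -/
theorem Sat.mul {a a' b b' : Matrix (Fin N) (Fin N) B} (ha : Sat G a a') (hb : Sat G b b')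
    (h₁ : ∀ i j k l, Commute (a i j) (b k l)) (h₂ : ∀ i j k l, Commute (a i j) (b' k l))
    (h₃ : ∀ i j k l, Commute (a' i j) (b k l)) (h₄ : ∀ i j k l, Commute (a' i j) (b' k l)) :
    Sat G (a * b) (a' * b') := by
  have t : (a * b).transpose = b.transpose * a.transpose := by
    ext i j
    simp only [Matrix.transpose_apply, Matrix.mul_apply]
    exact Finset.sum_congr rfl fun k _ => h₁ _ _ _ _
  have t' : (a' * b').transpose = b'.transpose * a'.transpose := by
    ext i j
    simp only [Matrix.transpose_apply, Matrix.mul_apply]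
    exact Finset.sum_congr rfl fun k _ => h₄ _ _ _ _
  have cancel : ∀ {p q r s : Matrix (Fin N) (Fin N) B}, q * r = 1 → p * s = 1 →
      p * q * (r * s) = 1 := by
    intro p q r s h h'
    rw [mul_assoc, ← mul_assoc q, h, one_mul, h']
  refine ⟨⟨?_, ?_, ?_, ?_⟩, fun hG => ?_⟩
  · rw [t']; exact cancel hb.1.mul_adj ha.1.mul_adj
  · rw [t']; exact cancel ha.1.adj_mul hb.1.adj_mul
  · rw [t]; exact cancel hb.1.conj_mul_adj ha.1.conj_mul_adj
  · rw [t]; exact cancel ha.1.conj_adj_mul hb.1.conj_adj_mul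
  have ra := ha.2 hG
  have rb := hb.2 hG
  have four : ∀ {p q r s : B}, Commute q r → p * q * (r * s) = p * r * (q * s) := by
    intro p q r s h
    rw [mul_assoc, ← mul_assoc q, h.eq, mul_assoc, mul_assoc]
  have P : ∀ i j, (a * b) i j * (a' * b') i j =
      ∑ k, a i k * a' i k * (b k j * b' k j) := by
    intro i j
    simp only [Matrix.mul_apply, Finset.sum_mul, Finset.mul_sum]
    refine Finset.sum_congr rfl fun k _ => ?_
    rw [Finset.sum_eq_single k]
    · exact four (h₃ _ _ _ _).symm
    · intro l _ hl
      rw [four (h₃ _ _ _ _).symm]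
      rw [ra.row_mul_adj i hl, zero_mul]
    · simp
  have P' : ∀ i j, (a' * b') i j * (a * b) i j =
      ∑ k, a i k * a' i k * (b k j * b' k j) := by
    intro i j
    simp only [Matrix.mul_apply, Finset.sum_mul, Finset.mul_sum]
    refine Finset.sum_congr rfl fun k _ => ?_
    rw [Finset.sum_eq_single k]
    · rw [four (h₂ _ _ _ _).symm, ra.normal, rb.normal]
    · intro l _ hl
      rw [four (h₂ _ _ _ _).symm]
      rw [ra.row_adj_mul i hl, zero_mul]
    · simp
  have c₁ : ∀ i j k l m n, Commute (b k l * b' k l) (a i j * a' m n) := fun i j k l m n =>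
    (((h₁ _ _ _ _).symm.mul_right (h₃ _ _ _ _).symm).mul_left
      ((h₂ _ _ _ _).symm.mul_right (h₄ _ _ _ _).symm))
  refine ⟨fun i j => ?_, fun i j => ?_, fun i j => ?_, fun i j k hjk => ?_, fun i j k hij => ?_⟩
  · rw [P, P']
  · rw [P]
    simp only [Matrix.mul_apply, Finset.sum_mul, Finset.mul_sum]
    rw [Finset.sum_comm]
    refine Finset.sum_congr rfl fun k _ => ?_
    rw [Finset.sum_eq_single k]
    · rw [four (((h₁ _ _ _ _).symm).mul_left (h₂ _ _ _ _).symm), ra.isometry, rb.isometry]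
    · intro l _ hl
      rw [four (((h₁ _ _ _ _).symm).mul_left (h₂ _ _ _ _).symm), mul_assoc (a _ _)]
      rw [ra.row_adj_mul i (Ne.symm hl), mul_zero, zero_mul]
    · simp
  · rw [P']
    simp only [Matrix.mul_apply, Finset.sum_mul, Finset.mul_sum]
    rw [Finset.sum_comm]
    refine Finset.sum_congr rfl fun k _ => ?_
    rw [Finset.sum_eq_single k]
    · rw [four (((h₃ _ _ _ _).symm).mul_left (h₄ _ _ _ _).symm), ra.proj_mul_adj,
        rb.proj_mul_adj]
    · intro l _ hl
      rw [four (((h₃ _ _ _ _).symm).mul_left (h₄ _ _ _ _).symm), ra.normal, mul_assoc (a' _ _)]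
      rw [ra.row_mul_adj i (Ne.symm hl), mul_zero, zero_mul]
    · simp
  · rw [P, P, Finset.sum_mul_sum]
    refine Finset.sum_eq_zero fun l _ => Finset.sum_eq_zero fun m _ => ?_
    rw [four (c₁ _ _ _ _ _ _)]
    by_cases hlm : l = m
    · subst hlm
      rw [rb.row l j k hjk, mul_zero]
    · rw [ra.row i l m hlm, zero_mul]
  · rw [P, P, Finset.sum_mul_sum]
    refine Finset.sum_eq_zero fun l _ => Finset.sum_eq_zero fun m _ => ?_
    rw [four (c₁ _ _ _ _ _ _)]
    by_cases hlm : l = m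
    · subst hlm
      rw [ra.col i j l hij, zero_mul]
    · rw [rb.col l m k hlm, mul_zero]

theorem Sat.map {C : Type*} [Ring C] {x y : Matrix (Fin N) (Fin N) B} (h : Sat G x y)
    (f : B →+* C) : Sat G (x.map f) (y.map f) := by
  have key : ∀ {p q : Matrix (Fin N) (Fin N) B}, p * q = 1 → p.map f * q.map f = 1 := by
    intro p q h
    rw [← Matrix.map_mul, h, Matrix.map_one f (map_zero _) (map_one _)]
  refine ⟨⟨key h.1.mul_adj, key h.1.adj_mul, key h.1.conj_mul_adj, key h.1.conj_adj_mul⟩,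
    fun hG => ?_⟩
  have r := h.2 hG
  refine ⟨fun i j => ?_, fun i j => ?_, fun i j => ?_, fun i j k h => ?_, fun i j k h => ?_⟩
  · simp only [Matrix.map_apply, ← map_mul, r.normal]
  · simp only [Matrix.map_apply, ← map_mul, r.isometry]
  · simp only [Matrix.map_apply, ← map_mul, r.isometry_adj]
  · simp only [Matrix.map_apply, ← map_mul, r.row i j k h, map_zero]
  · simp only [Matrix.map_apply, ← map_mul, r.col i j k h, map_zero]

end Coproduct

theorem sat_comul (G : Family) (N : ℕ) :
    Sat (B := Pol G N ⊗[ℂ] Pol G N) G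
      (Matrix.of fun i j => ∑ k, u G N i k ⊗ₜ[ℂ] u G N k j)
      (Matrix.of fun i j => ∑ k, v G N i k ⊗ₜ[ℂ] v G N k j) := by
  have hc : ∀ x y : Pol G N, Commute
      ((Algebra.TensorProduct.includeLeft : Pol G N →ₐ[ℂ] Pol G N ⊗[ℂ] Pol G N).toRingHom x)
      ((Algebra.TensorProduct.includeRight : Pol G N →ₐ[ℂ] Pol G N ⊗[ℂ] Pol G N).toRingHom y) := by
    intro x y
    simp [Commute, SemiconjBy]
  have h := Sat.mul
    ((sat G N).map
      (Algebra.TensorProduct.includeLeft : Pol G N →ₐ[ℂ] Pol G N ⊗[ℂ] Pol G N).toRingHom)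
    ((sat G N).map
      (Algebra.TensorProduct.includeRight : Pol G N →ₐ[ℂ] Pol G N ⊗[ℂ] Pol G N).toRingHom)
    (fun _ _ _ _ => hc _ _) (fun _ _ _ _ => hc _ _) (fun _ _ _ _ => hc _ _)
    (fun _ _ _ _ => hc _ _)
  convert h using 1
  · ext i j
    simp [Matrix.mul_apply]
  · ext i j
    simp [Matrix.mul_apply]

/-- The coproduct: `Δ(u_ij) = ∑ₖ u_ik ⊗ u_kj`. -/
def comulHom (G : Family) (N : ℕ) : Pol G N →ₐ[ℂ] Pol G N ⊗[ℂ] Pol G N :=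
  lift _ _ (sat_comul G N)

instance : Bialgebra ℂ (Pol G N) :=
  Bialgebra.ofAlgHom (comulHom G N) (counitHom G N)
    (by
      apply hom_ext <;> intro i j <;>
        simp [comulHom, TensorProduct.sum_tmul, TensorProduct.tmul_sum] <;>
        exact Finset.sum_comm)
    (by
      apply hom_ext <;> intro i j <;>
        simp [comulHom, counitHom, Matrix.one_apply, TensorProduct.ite_tmul])
    (by
      apply hom_ext <;> intro i j <;>
        simp [comulHom, counitHom, Matrix.one_apply, TensorProduct.tmul_ite])

theorem counit_u (i j : Fin N) :
    Coalgebra.counit (R := ℂ) (u G N i j) = if i = j then 1 else 0 :=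
  (lift_u _ _ (sat_counit G N) i j).trans Matrix.one_apply

theorem comul_u (i j : Fin N) :
    Coalgebra.comul (R := ℂ) (u G N i j) = ∑ k, u G N i k ⊗ₜ[ℂ] u G N k j :=
  lift_u _ _ (sat_comul G N) i j

theorem counit_v (i j : Fin N) :
    Coalgebra.counit (R := ℂ) (v G N i j) = if i = j then 1 else 0 :=
  (lift_v _ _ (sat_counit G N) i j).trans Matrix.one_apply

theorem comul_v (i j : Fin N) :
    Coalgebra.comul (R := ℂ) (v G N i j) = ∑ k, v G N i k ⊗ₜ[ℂ] v G N k j :=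
  lift_v _ _ (sat_comul G N) i j

/-! #### The circle of scalar matrices -/

theorem sat_scalar (G : Family) (N : ℕ) :
    Sat G (Matrix.diagonal fun _ : Fin N => (LaurentPolynomial.T 1 : PolT))
      (Matrix.diagonal fun _ : Fin N => (LaurentPolynomial.T (-1) : PolT)) := by
  have h₁ : (LaurentPolynomial.T 1 : PolT) * LaurentPolynomial.T (-1) = 1 := by
    rw [← LaurentPolynomial.T_add]
    simp
  have h₂ : (LaurentPolynomial.T (-1) : PolT) * LaurentPolynomial.T 1 = 1 := by
    rw [← LaurentPolynomial.T_add]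
    simp
  refine ⟨⟨?_, ?_, ?_, ?_⟩, fun _ => ?_⟩
  · rw [Matrix.diagonal_transpose, Matrix.diagonal_mul_diagonal, h₁, Matrix.diagonal_one]
  · rw [Matrix.diagonal_transpose, Matrix.diagonal_mul_diagonal, h₂, Matrix.diagonal_one]
  · rw [Matrix.diagonal_transpose, Matrix.diagonal_mul_diagonal, h₂, Matrix.diagonal_one]
  · rw [Matrix.diagonal_transpose, Matrix.diagonal_mul_diagonal, h₁, Matrix.diagonal_one]
  refine ⟨fun i j => mul_comm _ _, fun i j => ?_, fun i j => ?_, fun i j k h => ?_,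
    fun i j k h => ?_⟩
  · by_cases hij : i = j <;> simp [hij, h₁]
  · by_cases hij : i = j <;> simp [hij, h₂]
  · by_cases hij : i = j
    · subst hij
      rw [Matrix.diagonal_apply_ne _ h, zero_mul, mul_zero]
    · rw [Matrix.diagonal_apply_ne _ hij, zero_mul, zero_mul]
  · by_cases hij : i = k
    · subst hij
      rw [Matrix.diagonal_apply_ne _ (Ne.symm h), zero_mul, mul_zero]
    · rw [Matrix.diagonal_apply_ne _ hij, zero_mul, zero_mul]

/-- The homomorphism `Pol → Pol(𝕋)`, `u_ij ↦ δ_ij z`, that restricts to the circle of scalar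
matrices. -/
def toCircle (G : Family) (N : ℕ) : Pol G N →ₐc[ℂ] PolT :=
  BialgHom.ofAlgHom (lift _ _ (sat_scalar G N))
    (by
      apply hom_ext <;> intro i j <;> by_cases hij : i = j <;>
        simp [hij, counit_u, counit_v])
    (by
      apply hom_ext <;> intro i j <;> by_cases hij : i = j <;>
        simp [hij, comul_u, comul_v, Matrix.diagonal_apply, TensorProduct.ite_tmul])

theorem toCircle_u (i j : Fin N) :
    toCircle G N (u G N i j) = if i = j then LaurentPolynomial.T 1 else 0 :=
  (lift_u _ _ (sat_scalar G N) i j).trans (Matrix.diagonal_apply _ _ _)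

theorem toCircle_v (i j : Fin N) :
    toCircle G N (v G N i j) = if i = j then LaurentPolynomial.T (-1) else 0 :=
  (lift_v _ _ (sat_scalar G N) i j).trans (Matrix.diagonal_apply _ _ _)

/-- The map to `Pol(𝕋)` respects the involutions. -/
theorem toCircle_star (a : Pol G N) : toCircle G N (star a) = star (toCircle G N a) := by
  let f : Pol G N →ₐ[ℂ] PolT :=
    { toFun := fun a => star (toCircle G N (star a))
      map_one' := by simp
      map_mul' := fun a b => by simp [mul_comm]
      map_zero' := by simp
      map_add' := fun a b => by simp
      commutes' := fun c => by
        rw [star_algebraMap', Algebra.algebraMap_eq_smul_one, map_smul, map_one, star_smul,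
          star_one, Algebra.algebraMap_eq_smul_one]
        simp }
  have hf : f = (toCircle G N : Pol G N →ₐ[ℂ] PolT) := hom_ext
    (fun i j => by
      change star (toCircle G N (star (u G N i j))) = toCircle G N (u G N i j)
      rw [star_u, toCircle_u, toCircle_v]
      split_ifs
      · rw [star_T, neg_neg]
      · rw [star_zero])
    (fun i j => by
      change star (toCircle G N (star (v G N i j))) = toCircle G N (v G N i j)
      rw [star_v, toCircle_u, toCircle_v]
      split_ifs
      · rw [star_T]
      · rw [star_zero])
  have h := congrArg (fun g : Pol G N →ₐ[ℂ] PolT => g a) hf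
  rw [← star_star (toCircle G N (star a))]
  exact congrArg star h

/-- The circle is a quantum subgroup: the map to `Pol(𝕋)` is surjective. -/
theorem toCircle_surjective (hN : 1 ≤ N) : Function.Surjective (toCircle G N) := by
  have h : ∀ n : ℤ, ∃ a, toCircle G N a = LaurentPolynomial.T n := by
    intro n
    rcases Int.eq_nat_or_neg n with ⟨m, rfl | rfl⟩
    · refine ⟨u G N ⟨0, hN⟩ ⟨0, hN⟩ ^ m, ?_⟩
      rw [map_pow, toCircle_u, if_pos rfl, LaurentPolynomial.T_pow, mul_one]
    · refine ⟨v G N ⟨0, hN⟩ ⟨0, hN⟩ ^ m, ?_⟩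
      rw [map_pow, toCircle_v, if_pos rfl, LaurentPolynomial.T_pow, mul_neg, mul_one]
  intro f
  induction f using LaurentPolynomial.induction_on' with
  | add p q hp hq =>
    obtain ⟨a, rfl⟩ := hp
    obtain ⟨b, rfl⟩ := hq
    exact ⟨a + b, map_add _ _ _⟩
  | C_mul_T n c =>
    obtain ⟨a, ha⟩ := h n
    exact ⟨c • a, by rw [map_smul, ha, LaurentPolynomial.smul_eq_C_mul]⟩

end Pol

end QG
end

noncomputable section

namespace QG

/-! ### Functionals that vanish on powers of the augmentation ideal -/

section Functionals

variable {B : Type*} [Ring B] [Bialgebra ℂ B]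

local notation "ε" => Coalgebra.counit (R := ℂ)

/-! Scalar matrices commute with everything, so slicing the coproduct by `toCircle` on the left or
on the right gives the same result, and every functional that factors through the circle is central.
That is the easy direction, together with the cocycle formula `brownian_mul`, which makes Brownian
functionals Gaussian.

For the converse, slice the coproduct of a word in the `u_ij` by a central `φ` on either side; the
two slices agree (`IsCentral.slice_eq`). Mapping `u_ij` to `δ_ij g_i`, with free generators `g_i`,
shows that `φ` vanishes on words of length one and two with an off-diagonal letter. What is left of
the slice identity is a scalar identity times a word: `φ(u_ii u_kk) = φ(u_jj u_ll)` whenever `u_ij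
u_kl ≠ 0`, and likewise for other lengths. So everything depends on which words are nonzero.
Permutation matrices give one value `c` on all `u_ii`, one value on all `u_ii u_ii`, and one on all
`u_ii u_kk` with `i ≠ k`. For `U` the word `u_ii u_ij` is nonzero and identifies the last two. For
`H` it vanishes; there the nonzero word `u_ii u_jk u_ij` with three distinct indices does it, since
a Gaussian functional on words of length three is determined by shorter words. This is where `N ≥ 3`
enters.

Modulo the square of `ker ε`, `u_ji* - δ_ij` is `-(u_ij - δ_ij)`, so a functional killing `1` and `K
3` is determined by its values on the `u_ij` and on products of two of them
(`eq_zero_of_vanish_three`). Hence `φ` is determined by `c` and the common value `e` on length two.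
Positivity gives `μ = 2c - e ≥ 0`, unitarity gives `Re c = -μ/2`, and `φ` is the Brownian functional
with drift `Im c` and variance `μ`. -/

/-- The counit vanishes at `a - ε(a)1`. -/
theorem counit_sub_counit (a : B) : ε (a - ε a • (1 : B)) = 0 := by
  simp

theorem mul_mul_mem_K {a b c : B} (ha : ε a = 0) (hb : ε b = 0) (hc : ε c = 0) :
    a * b * c ∈ K B 3 := by
  rw [K, pow_succ, pow_two]
  exact Submodule.mul_mem_mul (Submodule.mul_mem_mul ha hb) hc

theorem eq_zero_of_mem_K_three {φ : B →ₗ[ℂ] ℂ}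
    (h : ∀ a b c : B, ε a = 0 → ε b = 0 → ε c = 0 → φ (a * b * c) = 0) {x : B}
    (hx : x ∈ K B 3) : φ x = 0 := by
  rw [K, pow_succ, pow_two] at hx
  refine Submodule.mul_induction_on hx (fun m hm c hc => ?_) fun x y hx hy => ?_
  · refine Submodule.mul_induction_on hm (fun a ha b hb => h a b c ha hb hc) fun x y hx hy => ?_
    rw [add_mul, map_add, hx, hy, add_zero]
  · rw [map_add, hx, hy, add_zero]

/-- A functional vanishing at `1` and on `(ker ε)²` is an `ε`-derivation. -/
theorem map_mul_of_vanish_two {f : B →ₗ[ℂ] ℂ} (h1 : f 1 = 0)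
    (h2 : ∀ a b, ε a = 0 → ε b = 0 → f (a * b) = 0) (a b : B) :
    f (a * b) = ε a * f b + f a * ε b := by
  have h := h2 _ _ (counit_sub_counit a) (counit_sub_counit b)
  simp only [sub_mul, mul_sub, map_sub, smul_mul_assoc, mul_smul_comm, map_smul, one_mul, mul_one,
    h1, smul_eq_mul] at h
  linear_combination h

/-- The values of a functional vanishing at `1` and on `(ker ε)³` on products of three elements. -/
theorem map_mul_mul_of_vanish_three {f : B →ₗ[ℂ] ℂ} (h1 : f 1 = 0)
    (h3 : ∀ x ∈ K B 3, f x = 0) (a b c : B) :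
    f (a * b * c) = f (a * b) * ε c + f (a * c) * ε b + f (b * c) * ε a
      - f a * (ε b * ε c) - f b * (ε a * ε c) - f c * (ε a * ε b) := by
  have h := h3 _ (mul_mul_mem_K (counit_sub_counit a) (counit_sub_counit b) (counit_sub_counit c))
  simp only [sub_mul, mul_sub, map_sub, smul_mul_assoc, mul_smul_comm, map_smul, one_mul, mul_one,
    h1, smul_eq_mul, smul_sub] at h
  linear_combination h

theorem IsGaussian.comp {C : Type*} [Ring C] [Bialgebra ℂ C] [StarRing B] [StarRing C]
    {ψ : C →ₗ[ℂ] ℂ} (hψ : IsGaussian ψ) (π : B →ₐc[ℂ] C) (hπ : ∀ a, π (star a) = star (π a)) :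
    IsGaussian (ψ ∘ₗ (π : B →ₗ[ℂ] C)) := by
  have hε : ∀ a, ε a = 0 → ε (π a) = 0 := fun a ha => by
    rw [CoalgHomClass.counit_comp_apply, ha]
  refine ⟨⟨?_, fun b => ?_, fun b hb => ?_⟩, fun x hx => ?_⟩
  · change ψ (π 1) = 0
    rw [map_one, hψ.generating.map_one]
  · change ψ (π (star b)) = star (ψ (π b))
    rw [hπ, hψ.generating.map_star]
  · change 0 ≤ ψ (π (star b * b))
    rw [map_mul, hπ]
    exact hψ.generating.nonneg _ (hε b hb)
  · refine eq_zero_of_mem_K_three (fun a b c ha hb hc => ?_) hx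
    change ψ (π (a * b * c)) = 0
    rw [map_mul π, map_mul π]
    exact hψ.map_K_three _ (mul_mul_mem_K (hε a ha) (hε b hb) (hε c hc))

end Functionals

/-! ### Brownian functionals on the circle -/

section Circle

local notation "ε" => Coalgebra.counit (R := ℂ) (A := PolT)

theorem PolT.induction {p : PolT → Prop} (hT : ∀ n : ℤ, p (LaurentPolynomial.T n))
    (hadd : ∀ a b, p a → p b → p (a + b)) (hsmul : ∀ (c : ℂ) a, p a → p (c • a)) (f : PolT) :
    p f := by
  induction f using LaurentPolynomial.induction_on' with
  | add a b ha hb => exact hadd a b ha hb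
  | C_mul_T n c =>
    rw [← LaurentPolynomial.smul_eq_C_mul]
    exact hsmul c _ (hT n)

/-- The cocycle formula: `brownian 1 0` is the `ε`-derivation `zⁿ ↦ i n`, and the cross term of
`-μ(n+m)²/2` is `-μ n m = μ (i n)(i m)`. -/
theorem brownian_mul (ν : ℝ) (μ : ℝ≥0) (f g : PolT) :
    brownian ν μ (f * g) = brownian ν μ f * ε g + ε f * brownian ν μ g
      + μ * (brownian 1 0 f * brownian 1 0 g) := by
  induction f using PolT.induction with
  | hadd a b ha hb => simp only [add_mul, map_add, ha, hb]; ring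
  | hsmul c a ha => simp only [smul_mul_assoc, map_smul, ha, smul_eq_mul]; ring
  | hT n =>
    induction g using PolT.induction with
    | hadd a b ha hb => simp only [mul_add, map_add, ha, hb]; ring
    | hsmul c a ha => simp only [mul_smul_comm, map_smul, ha, smul_eq_mul]; ring
    | hT m =>
      rw [← LaurentPolynomial.T_add]
      simp only [brownian_T, LaurentPolynomial.counit_T]
      push_cast
      linear_combination (-μ * n * m : ℂ) * Complex.I_mul_I

theorem brownian_star (ν : ℝ) (μ : ℝ≥0) (f : PolT) :
    brownian ν μ (star f) = star (brownian ν μ f) := by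
  induction f using PolT.induction with
  | hadd a b ha hb => simp only [star_add, map_add, ha, hb]
  | hsmul c a ha => simp only [star_smul, map_smul, ha, smul_eq_mul, star_mul']
  | hT n =>
    rw [star_T, brownian_T, brownian_T]
    simp

theorem brownian_one (ν : ℝ) (μ : ℝ≥0) : brownian ν μ 1 = 0 := by
  rw [← LaurentPolynomial.T_zero, brownian_T]
  simp

/-- On `ker ε` the cocycle formula leaves only `μ d(f) d(g)` with `d = brownian 1 0`. As `d` is
hermitian, `f* f` gives `μ |d(f)|² ≥ 0`; as `d` is a derivation, it kills products of two elements
of `ker ε`, hence the functional kills products of three. -/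
theorem isGaussian_brownian (ν : ℝ) (μ : ℝ≥0) : IsGaussian (brownian ν μ) := by
  have hstar : ∀ f : PolT, ε (star f) = star (ε f) := by
    intro f
    induction f using PolT.induction with
    | hadd a b ha hb => simp only [star_add, map_add, ha, hb]
    | hsmul c a ha => simp only [star_smul, map_smul, ha, smul_eq_mul, star_mul']
    | hT n => rw [star_T, LaurentPolynomial.counit_T, LaurentPolynomial.counit_T, star_one]
  refine ⟨⟨brownian_one ν μ, brownian_star ν μ, fun b hb => ?_⟩, fun x hx => ?_⟩
  · rw [brownian_mul, hstar, hb, star_zero, brownian_star 1 0]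
    simp only [mul_zero, zero_mul, add_zero, zero_add]
    exact mul_nonneg (by exact_mod_cast μ.2) (star_mul_self_nonneg _)
  · refine eq_zero_of_mem_K_three (fun a b c ha hb hc => ?_) hx
    rw [brownian_mul, brownian_mul 1 0, Bialgebra.counit_mul, ha, hb, hc]
    simp

theorem brownian_injective {ν ν' : ℝ} {μ μ' : ℝ≥0} (h : brownian ν μ = brownian ν' μ') :
    ν = ν' ∧ μ = μ' := by
  have h1 := congrArg (fun f : PolT →ₗ[ℂ] ℂ => f (LaurentPolynomial.T 1)) h
  simp only [brownian_T] at h1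
  have hre := congrArg Complex.re h1
  have him := congrArg Complex.im h1
  simp at hre him
  exact ⟨him, hre⟩

theorem exp_brownian_T (ν : ℝ) (μ t : ℝ≥0) (n : ℤ) :
    Complex.exp (t * brownian ν μ (LaurentPolynomial.T n)) =
      ∫ x : ℝ, Complex.exp (Complex.I * n * x)
        ∂(ProbabilityTheory.gaussianReal (ν * t) (μ * t)) := by
  have h := ProbabilityTheory.charFun_gaussianReal (μ := ν * t) (v := μ * t) (n : ℝ)
  rw [MeasureTheory.charFun_apply_real] at h
  rw [brownian_T]
  convert h.symm using 2
  · push_cast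
    ring
  · ext x
    congr 1
    push_cast
    ring

end Circle

namespace Pol

variable {G : Family} {N : ℕ}

/-! ### Functionals on `Pol` that vanish on powers of the augmentation ideal -/

section Vanishing

local notation "ε" => Coalgebra.counit (R := ℂ) (A := Pol G N)

theorem subalgebra_eq_top {S : Subalgebra ℂ (Pol G N)} (hu : ∀ i j, u G N i j ∈ S)
    (hv : ∀ i j, v G N i j ∈ S) (a : Pol G N) : a ∈ S := by
  obtain ⟨w, rfl⟩ : ∃ w, mk G N w = a := RingQuot.mkAlgHom_surjective ℂ (Rel G N) a
  induction w using FreeAlgebra.induction with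
  | grade0 r => rw [AlgHom.commutes]; exact S.algebraMap_mem r
  | grade1 l =>
    cases l with
    | u i j => exact hu i j
    | uStar i j => exact hv i j
  | mul a b ha hb => rw [map_mul]; exact S.mul_mem ha hb
  | add a b ha hb => rw [map_add]; exact S.add_mem ha hb

/-- An `ε`-derivation takes opposite values at `u_ij` and `u_ji*`. -/
theorem map_v_of_vanish_two {f : Pol G N →ₗ[ℂ] ℂ} (h1 : f 1 = 0)
    (h2 : ∀ a b, ε a = 0 → ε b = 0 → f (a * b) = 0) (i j : Fin N) :
    f (v G N j i) = - f (u G N i j) := by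
  -- The relation used is `∑ₖ u_ik u_jk* = δ_ij`; the derivation rule leaves only `k = i` in one sum
  -- and `k = j` in the other.
  have h := congrArg f (congrFun (congrFun (sat G N).1.mul_adj i) j)
  rw [Matrix.mul_apply, map_sum] at h
  simp only [Matrix.transpose_apply, map_mul_of_vanish_two h1 h2, counit_u, counit_v] at h
  have h0 : f ((1 : Matrix (Fin N) (Fin N) (Pol G N)) i j) = 0 := by
    rw [Matrix.one_apply]
    split_ifs
    · exact h1
    · exact map_zero f
  rw [h0, Finset.sum_add_distrib] at h
  simp at h
  linear_combination h

/-- The zero set of an `ε`-derivation need not be a subalgebra because of the counit terms alone,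
but here both factors are killed, so it is one; it contains the `u_ij`, and hence their adjoints. -/
theorem eq_zero_of_vanish_two {f : Pol G N →ₗ[ℂ] ℂ} (h1 : f 1 = 0)
    (h2 : ∀ a b, ε a = 0 → ε b = 0 → f (a * b) = 0) (hu : ∀ i j, f (u G N i j) = 0) : f = 0 := by
  let S : Subalgebra ℂ (Pol G N) :=
    { carrier := {a | f a = 0}
      mul_mem' := fun {a b} (ha : f a = 0) (hb : f b = 0) => by
        change f (a * b) = 0
        rw [map_mul_of_vanish_two h1 h2, ha, hb, mul_zero, zero_mul, add_zero]
      add_mem' := fun {a b} (ha : f a = 0) (hb : f b = 0) => by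
        change f (a + b) = 0
        rw [map_add, ha, hb, add_zero]
      algebraMap_mem' := fun c => by
        change f _ = 0
        rw [Algebra.algebraMap_eq_smul_one, map_smul, h1, smul_zero] }
  ext a
  exact subalgebra_eq_top (S := S) hu
    (fun i j => by
      change f _ = 0
      rw [map_v_of_vanish_two h1 h2, hu, neg_zero]) a

/-- The projection `a ↦ a - ε(a)1` onto the kernel of the counit. -/
def augment (G : Family) (N : ℕ) : Pol G N →ₗ[ℂ] Pol G N :=
  LinearMap.id - LinearMap.smulRight (Coalgebra.counit (R := ℂ)) (1 : Pol G N)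

theorem augment_apply (a : Pol G N) : augment G N a = a - ε a • 1 := rfl

theorem counit_augment (a : Pol G N) : ε (augment G N a) = 0 := counit_sub_counit a

theorem augment_of_counit_eq_zero {a : Pol G N} (ha : ε a = 0) : augment G N a = a := by
  rw [augment_apply, ha, zero_smul, sub_zero]

theorem augment_one : augment G N 1 = 0 := by simp [augment_apply]

/-- A functional that vanishes at `1` and on `(ker ε)³` is determined by its values on
the `u_ij` and on the products of two of them. -/
theorem eq_zero_of_vanish_three {f : Pol G N →ₗ[ℂ] ℂ} (h1 : f 1 = 0)
    (h3 : ∀ x ∈ K (Pol G N) 3, f x = 0) (hu : ∀ i j, f (u G N i j) = 0)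
    (huu : ∀ i j k l, f (u G N i j * u G N k l) = 0) : f = 0 := by
  have gen : ∀ i j b, ε b = 0 → f (augment G N (u G N i j) * b) = 0 := by
    intro i j b hb
    -- With one factor fixed in `ker ε`, vanishing on triple products becomes vanishing on double
    -- products in the other factor. This reduces to generators on the right, and the same device
    -- below on the left.
    have h : f ∘ₗ LinearMap.mulLeft ℂ (augment G N (u G N i j)) ∘ₗ augment G N = 0 := by
      refine eq_zero_of_vanish_two ?_ (fun a b ha hb => ?_) fun k l => ?_
      · simp [augment_one]
      · rw [LinearMap.comp_apply, LinearMap.comp_apply, LinearMap.mulLeft_apply,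
          augment_of_counit_eq_zero (a := a * b) (by rw [Bialgebra.counit_mul, ha, zero_mul]), ← mul_assoc]
        exact h3 _ (mul_mul_mem_K (counit_augment _) ha hb)
      · simp [augment_apply, sub_mul, mul_sub, hu, huu, h1]
    have h' := congrArg (fun g : Pol G N →ₗ[ℂ] ℂ => g b) h
    simpa [augment_of_counit_eq_zero hb] using h'
  refine eq_zero_of_vanish_two h1 (fun a b ha hb => ?_) hu
  have h : f ∘ₗ LinearMap.mulRight ℂ b ∘ₗ augment G N = 0 := by
    refine eq_zero_of_vanish_two ?_ (fun a c ha hc => ?_) fun k l => ?_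
    · simp [augment_one]
    · rw [LinearMap.comp_apply, LinearMap.comp_apply, LinearMap.mulRight_apply,
        augment_of_counit_eq_zero (by rw [Bialgebra.counit_mul, ha, zero_mul])]
      exact h3 _ (mul_mul_mem_K ha hc hb)
    · exact gen k l b hb
  have h' := congrArg (fun g : Pol G N →ₗ[ℂ] ℂ => g a) h
  simpa [augment_of_counit_eq_zero ha] using h'

/-- For a functional vanishing on `(ker ε)³`, an adjacent factor `u_ji* - δ_ij` may be replaced
by `-(u_ij - δ_ij)`. -/
theorem map_augment_v_mul {f : Pol G N →ₗ[ℂ] ℂ} (h3 : ∀ x ∈ K (Pol G N) 3, f x = 0)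
    (i j : Fin N) {b : Pol G N} (hb : ε b = 0) :
    f (augment G N (v G N j i) * b) = - f (augment G N (u G N i j) * b) := by
  refine map_v_of_vanish_two (f := f ∘ₗ LinearMap.mulRight ℂ b ∘ₗ augment G N) ?_
    (fun a c ha hc => ?_) i j
  · simp [augment_one]
  · rw [LinearMap.comp_apply, LinearMap.comp_apply, LinearMap.mulRight_apply,
      augment_of_counit_eq_zero (by rw [Bialgebra.counit_mul, ha, zero_mul])]
    exact h3 _ (mul_mul_mem_K ha hc hb)

end Vanishing

/-! ### Functionals that factor through the circle are central -/

/-- Centrality of the scalar matrices. Both sides are algebra homomorphisms, and both send `u_ij` to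
`z ⊗ u_ij` and `u_ij*` to `z⁻¹ ⊗ u_ij*`. -/
theorem tmul_toCircle_comul (a : Pol G N) :
    TensorProduct.map (toCircle G N : Pol G N →ₗ[ℂ] PolT) LinearMap.id (Coalgebra.comul a) =
      TensorProduct.comm ℂ _ _
        (TensorProduct.map LinearMap.id (toCircle G N : Pol G N →ₗ[ℂ] PolT)
          (Coalgebra.comul a)) := by
  let p : Pol G N →ₐ[ℂ] PolT := toCircle G N
  have h : (Algebra.TensorProduct.map p (AlgHom.id ℂ (Pol G N))).comp
        (Bialgebra.comulAlgHom ℂ (Pol G N)) =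
      ((Algebra.TensorProduct.comm ℂ (Pol G N) PolT : _ →ₐ[ℂ] _).comp
        (Algebra.TensorProduct.map (AlgHom.id ℂ (Pol G N)) p)).comp
        (Bialgebra.comulAlgHom ℂ (Pol G N)) := by
    have hpu : ∀ i j, p (u G N i j) = if i = j then LaurentPolynomial.T 1 else 0 := toCircle_u
    have hpv : ∀ i j, p (v G N i j) = if i = j then LaurentPolynomial.T (-1) else 0 := toCircle_v
    apply hom_ext <;> intro i j <;>
      simp [comul_u, comul_v, hpu, hpv, TensorProduct.ite_tmul, TensorProduct.tmul_ite]
  exact congrArg (fun g : Pol G N →ₐ[ℂ] PolT ⊗[ℂ] Pol G N => g a) h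

theorem isCentral_comp_toCircle (ψ : PolT →ₗ[ℂ] ℂ) :
    IsCentral (ψ ∘ₗ (toCircle G N : Pol G N →ₗ[ℂ] PolT)) := by
  intro χ
  ext a
  have hl : conv (ψ ∘ₗ (toCircle G N : Pol G N →ₗ[ℂ] PolT)) χ a =
      LinearMap.mul' ℂ ℂ (TensorProduct.map ψ χ
        (TensorProduct.map (toCircle G N : Pol G N →ₗ[ℂ] PolT) LinearMap.id
          (Coalgebra.comul a))) := by
    rw [TensorProduct.map_map, LinearMap.comp_id]
    rfl
  have hr : conv χ (ψ ∘ₗ (toCircle G N : Pol G N →ₗ[ℂ] PolT)) a =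
      LinearMap.mul' ℂ ℂ (TensorProduct.map χ ψ
        (TensorProduct.map LinearMap.id (toCircle G N : Pol G N →ₗ[ℂ] PolT)
          (Coalgebra.comul a))) := by
    rw [TensorProduct.map_map, LinearMap.comp_id]
    rfl
  rw [hl, hr, tmul_toCircle_comul]
  generalize TensorProduct.map LinearMap.id (toCircle G N : Pol G N →ₗ[ℂ] PolT)
    (Coalgebra.comul a) = t
  induction t with
  | zero => simp
  | add x y hx hy => simp only [map_add, hx, hy]
  | tmul x y => simp [mul_comm]

end Pol

namespace Pol

variable {G : Family} {N : ℕ}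

/-! ### Representations -/

section Representations

variable {B : Type*} [Ring B]

/-- A magic unitary `p` and units `z_i` commuting with its `i`-th row give the matrix
`(z_i p_ij)`, which satisfies the relations of both families. -/
theorem sat_units_mul (G : Family) (p : Matrix (Fin N) (Fin N) B) (z : Fin N → Bˣ)
    (hrow : ∀ i j k, p i j * p i k = if j = k then p i j else 0)
    (hcol : ∀ i j k, p i k * p j k = if i = j then p i k else 0)
    (hrow_sum : ∀ i, ∑ j, p i j = 1) (hcol_sum : ∀ j, ∑ i, p i j = 1)
    (hz : ∀ i j, Commute (z i : B) (p i j)) :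
    Sat G (Matrix.of fun i j => (z i : B) * p i j)
      (Matrix.of fun i j => ((z i)⁻¹ : Bˣ) * p i j) := by
  have hz' : ∀ i j, Commute (((z i)⁻¹ : Bˣ) : B) (p i j) := fun i j => (hz i j).units_inv_left
  have same : ∀ i j k, (z i : B) * p i j * (((z i)⁻¹ : Bˣ) * p i k) = if j = k then p i j else 0 := by
    intro i j k
    rw [← hrow, (hz i j).eq, mul_assoc, Units.mul_inv_cancel_left]
  have same' : ∀ i j k, (((z i)⁻¹ : Bˣ) : B) * p i j * (z i * p i k) = if j = k then p i j else 0 := by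
    intro i j k
    rw [← hrow, (hz' i j).eq, mul_assoc, Units.inv_mul_cancel_left]
  have diff : ∀ {i j : Fin N} (k : Fin N) (a b : Bˣ), Commute (b : B) (p j k) → i ≠ j →
      (a : B) * p i k * (b * p j k) = 0 := by
    intro i j k a b hb hij
    rw [hb.eq, mul_assoc, ← mul_assoc (p i k), hcol, if_neg hij, zero_mul, mul_zero]
  refine ⟨⟨?_, ?_, ?_, ?_⟩, fun _ => ⟨fun i j => ?_, fun i j => ?_, fun i j => ?_,
    fun i j k h => ?_, fun i j k h => ?_⟩⟩
  · ext i j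
    simp only [Matrix.mul_apply, Matrix.transpose_apply, Matrix.of_apply]
    by_cases hij : i = j
    · subst hij
      simp [same, hrow_sum]
    · rw [Matrix.one_apply_ne hij]
      exact Finset.sum_eq_zero fun k _ => diff k _ _ (hz' _ _) hij
  · ext i j
    simp only [Matrix.mul_apply, Matrix.transpose_apply, Matrix.of_apply, same']
    by_cases hij : i = j <;> simp [hij, hcol_sum, Matrix.one_apply]
  · ext i j
    simp only [Matrix.mul_apply, Matrix.transpose_apply, Matrix.of_apply]
    by_cases hij : i = j
    · subst hij
      simp [same', hrow_sum]
    · rw [Matrix.one_apply_ne hij]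
      exact Finset.sum_eq_zero fun k _ => diff k _ _ (hz _ _) hij
  · ext i j
    simp only [Matrix.mul_apply, Matrix.transpose_apply, Matrix.of_apply, same]
    by_cases hij : i = j <;> simp [hij, hcol_sum, Matrix.one_apply]
  · simp only [Matrix.of_apply, same, same']
  · simp only [Matrix.of_apply, same, if_true]
    rw [← mul_assoc, ← (hz i j).eq, mul_assoc, hrow, if_pos rfl]
  · simp only [Matrix.of_apply, same', if_true]
    rw [← mul_assoc, ← (hz' i j).eq, mul_assoc, hrow, if_pos rfl]
  · simp only [Matrix.of_apply, same, if_true]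
    rw [hrow, if_neg h]
  · simp only [Matrix.of_apply, same, if_true]
    rw [hcol, if_neg h]

/-- Generators of the free group as diagonal entries. -/
theorem sat_freeGroup (G : Family) (N : ℕ) :
    Sat G
      (Matrix.diagonal fun i : Fin N => MonoidAlgebra.of ℂ (FreeGroup (Fin N)) (FreeGroup.of i))
      (Matrix.diagonal fun i : Fin N =>
        MonoidAlgebra.of ℂ (FreeGroup (Fin N)) (FreeGroup.of i)⁻¹) := by
  have h := sat_units_mul (B := MonoidAlgebra ℂ (FreeGroup (Fin N))) G 1
    (fun i : Fin N => Units.map (MonoidAlgebra.of ℂ (FreeGroup (Fin N)))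
      (toUnits (FreeGroup.of i)))
    (fun i j k => by by_cases hij : i = j <;> simp [Matrix.one_apply, hij])
    (fun i j k => by by_cases hij : i = k <;> simp [Matrix.one_apply, hij, eq_comm])
    (fun i => by simp [Matrix.one_apply]) (fun i => by simp [Matrix.one_apply])
    (fun i j => by by_cases hij : i = j <;> simp [Matrix.one_apply, hij])
  convert h using 1
  · ext1 i j
    by_cases hij : i = j <;> simp [hij, Matrix.one_apply]
  · ext1 i j
    by_cases hij : i = j <;>
      simp [hij, Matrix.one_apply, ← map_inv]

/-- A family of permutations, as a magic unitary with entries in diagonal matrices. -/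
def permMagic {ι : Type*} [DecidableEq ι] (σ : ι → Equiv.Perm (Fin N)) :
    Matrix (Fin N) (Fin N) (Matrix ι ι ℂ) :=
  Matrix.of fun i j => Matrix.diagonal fun s => if σ s i = j then 1 else 0

theorem sat_permMagic {ι : Type*} [Fintype ι] [DecidableEq ι] (G : Family)
    (σ : ι → Equiv.Perm (Fin N)) (z : Fin N → (Matrix ι ι ℂ)ˣ)
    (hz : ∀ i j, Commute (z i : Matrix ι ι ℂ) (permMagic σ i j)) :
    Sat G (Matrix.of fun i j => (z i : Matrix ι ι ℂ) * permMagic σ i j)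
      (Matrix.of fun i j => ((z i)⁻¹ : (Matrix ι ι ℂ)ˣ) * permMagic σ i j) := by
  refine sat_units_mul G _ z (fun i j k => ?_) (fun i j k => ?_) (fun i => ?_) (fun j => ?_) hz
  · simp only [permMagic, Matrix.of_apply, Matrix.diagonal_mul_diagonal]
    split_ifs with h
    · simp [h]
    · rw [← Matrix.diagonal_zero]
      congr 1
      ext s
      by_cases h' : σ s i = j <;> simp [h', h]
  · simp only [permMagic, Matrix.of_apply, Matrix.diagonal_mul_diagonal]
    split_ifs with h
    · simp [h]
    · rw [← Matrix.diagonal_zero]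
      congr 1
      ext s
      by_cases h' : σ s i = k
      · subst h'
        simp [Ne.symm h]
      · simp [h']
  · ext s t
    by_cases h : s = t <;> simp [permMagic, Matrix.sum_apply, Matrix.one_apply, h]
  · ext s t
    by_cases h : s = t
    · subst h
      simp [permMagic, Matrix.sum_apply, ← Equiv.eq_symm_apply]
    · simp [permMagic, Matrix.sum_apply, h]

/-- The reflection along the vector `e_i + 2 e_j`. -/
theorem sat_reflection {i j : Fin N} (hij : i ≠ j) :
    ∃ x : Matrix (Fin N) (Fin N) ℂ, Sat .U x x ∧ x i i ≠ 0 ∧ x i j ≠ 0 := by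
  -- The weights are unequal because the reflection along `e_i + e_j` has a zero at `(i, i)`; here
  -- the entries at `(i, i)` and `(i, j)` are `3/5` and `-4/5`.
  let w : Fin N → ℂ := Pi.single i 1 + Pi.single j 2
  have hw : w ⬝ᵥ w = 5 := by
    simp [w, hij, Ne.symm hij]
    norm_num
  let W := Matrix.vecMulVec w w
  have hWW : W * W = (5 : ℂ) • W := by
    rw [Matrix.vecMulVec_mul_vecMulVec, hw]
    ext a b
    simp [W, Matrix.vecMulVec_apply]
    ring
  -- The matrix is real and symmetric, so all four unitarity relations say that its square is `1`.
  have ht : (1 - (2 / 5 : ℂ) • W).transpose = 1 - (2 / 5 : ℂ) • W := by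
    ext a b
    simp [W, Matrix.vecMulVec_apply, Matrix.one_apply, mul_comm, eq_comm]
  have h1 : (1 - (2 / 5 : ℂ) • W) * (1 - (2 / 5 : ℂ) • W) = 1 := by
    simp only [sub_mul, mul_sub, one_mul, mul_one, smul_mul_assoc, mul_smul_comm, hWW]
    module
  refine ⟨1 - (2 / 5 : ℂ) • W, ⟨⟨?_, ?_, ?_, ?_⟩, fun h => nomatch h⟩, ?_, ?_⟩
  · rw [ht, h1]
  · rw [ht, h1]
  · rw [ht, h1]
  · rw [ht, h1]
  · simp [W, w, Matrix.vecMulVec_apply, hij]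
    norm_num
  · simp [W, w, Matrix.vecMulVec_apply, hij, Ne.symm hij]

end Representations

end Pol

/-! ### Slicing the coproduct by a central functional -/

/-- The two slices of the coproduct by a central functional agree. -/
theorem IsCentral.slice_eq {B : Type*} [Ring B] [Bialgebra ℂ B] {φ : B →ₗ[ℂ] ℂ}
    (hφ : IsCentral φ) (a : B) :
    TensorProduct.lid ℂ B (TensorProduct.map φ LinearMap.id (Coalgebra.comul a)) =
      TensorProduct.rid ℂ B (TensorProduct.map LinearMap.id φ (Coalgebra.comul a)) := by
  -- Linear functionals separate the points of a complex vector space, so it suffices to test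
  -- against every `χ`, which is what centrality provides.
  rw [← sub_eq_zero, ← Module.forall_dual_apply_eq_zero_iff ℂ]
  intro χ
  rw [map_sub, sub_eq_zero]
  have hl : ∀ t : B ⊗[ℂ] B, χ (TensorProduct.lid ℂ B (TensorProduct.map φ LinearMap.id t)) =
      LinearMap.mul' ℂ ℂ (TensorProduct.map φ χ t) := by
    intro t
    induction t with
    | zero => simp
    | add x y hx hy => simp only [map_add, hx, hy]
    | tmul x y => simp
  have hr : ∀ t : B ⊗[ℂ] B, χ (TensorProduct.rid ℂ B (TensorProduct.map LinearMap.id φ t)) =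
      LinearMap.mul' ℂ ℂ (TensorProduct.map χ φ t) := by
    intro t
    induction t with
    | zero => simp
    | add x y hx hy => simp only [map_add, hx, hy]
    | tmul x y => simp [mul_comm]
  rw [hl, hr]
  exact congrArg (fun f : B →ₗ[ℂ] ℂ => f a) (hφ χ)

namespace Pol

variable {G : Family} {N : ℕ}

/-! ### Nonvanishing words -/

theorem ne_zero_of_sat {B : Type*} [Ring B] [Algebra ℂ B] {x y : Matrix (Fin N) (Fin N) B}
    (h : Sat G x y) {a : Pol G N} (ha : lift x y h a ≠ 0) : a ≠ 0 := by
  rintro rfl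
  exact ha (map_zero _)

theorem exists_perm {i j k l : Fin N} (hik : i ≠ k) (hjl : j ≠ l) :
    ∃ σ : Equiv.Perm (Fin N), σ i = j ∧ σ k = l := by
  -- The first swap sends `i` to `j`; the second moves the resulting image of `k` to `l` and fixes
  -- `j`, which differs from both.
  refine ⟨Equiv.swap (Equiv.swap i j k) l * Equiv.swap i j, ?_, ?_⟩
  · rw [Equiv.Perm.mul_apply, Equiv.swap_apply_left]
    refine Equiv.swap_apply_of_ne_of_ne (fun h => hik ?_) hjl
    rw [← Equiv.swap_apply_left i j] at h
    exact (Equiv.swap i j).injective (by simpa using h)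
  · rw [Equiv.Perm.mul_apply, Equiv.swap_apply_left]

/-- A permutation matrix is a character under which both letters become `1`. The case `i = k` is
included and is needed for squares. -/
theorem u_mul_u_ne_zero_of_perm (σ : Equiv.Perm (Fin N)) (i k : Fin N) :
    u G N i (σ i) * u G N k (σ k) ≠ 0 := by
  refine ne_zero_of_sat
    (sat_permMagic G (fun _ : Unit => σ) 1 fun i j => Commute.one_left _) ?_
  rw [map_mul, lift_u, lift_u]
  simp [permMagic]

theorem u_mul_u_ne_zero {i j k l : Fin N} (hik : i ≠ k) (hjl : j ≠ l) :
    u G N i j * u G N k l ≠ 0 := by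
  obtain ⟨σ, rfl, rfl⟩ := exists_perm hik hjl
  exact u_mul_u_ne_zero_of_perm σ i k

theorem u_ne_zero (i j : Fin N) : u G N i j ≠ 0 := by
  have h := u_mul_u_ne_zero_of_perm (G := G) (Equiv.swap i j) i i
  rw [Equiv.swap_apply_left] at h
  exact left_ne_zero_of_mul h

theorem u_mul_u_ne_zero_of_unitary {i j : Fin N} (hij : i ≠ j) :
    u .U N i i * u .U N i j ≠ 0 := by
  obtain ⟨x, hx, hii, hxij⟩ := sat_reflection hij
  refine ne_zero_of_sat hx ?_
  rw [map_mul, lift_u, lift_u]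
  exact mul_ne_zero hii hxij

/-- The `2 × 2` flip as a unit. -/
def flip : (Matrix (Fin 2) (Fin 2) ℂ)ˣ where
  val := !![0, 1; 1, 0]
  inv := !![0, 1; 1, 0]
  val_inv := by simp [Matrix.one_fin_two]
  inv_val := by simp [Matrix.one_fin_two]

/-- Two permutations that agree at `j` and differ at `i`, with a unitary at `j` that mixes them. -/
theorem u_mul_u_mul_u_ne_zero {i j k : Fin N} (hij : i ≠ j) (hik : i ≠ k) (hjk : j ≠ k) :
    u G N i i * u G N j k * u G N i j ≠ 0 := by
  -- In the resulting magic unitary the entry `(j, k)` is `1`, while `(i, i)` and `(i, j)` are the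
  -- two diagonal matrix units. Row `j` consists of `0` and `1`, so it may be multiplied by any
  -- unit, here the flip.
  let σ : Fin 2 → Equiv.Perm (Fin N) :=
    ![Equiv.swap j k, Equiv.swap i j * Equiv.swap j k]
  have hσ : ∀ s, σ s j = k := by
    intro s
    fin_cases s
    · simp [σ]
    · simp [σ, Equiv.swap_apply_of_ne_of_ne (Ne.symm hik) (Ne.symm hjk)]
  have h0 : σ 0 i = i := Equiv.swap_apply_of_ne_of_ne hij hik
  have h1 : σ 1 i = j := by simp [σ, Equiv.swap_apply_of_ne_of_ne hij hik]
  refine ne_zero_of_sat (sat_permMagic G σ (Pi.mulSingle j flip) fun a b => ?_) ?_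
  · by_cases ha : a = j
    · subst ha
      by_cases hb : k = b
      · have : permMagic σ a b = 1 := by simp [permMagic, hσ, hb]
        rw [this]
        exact Commute.one_right _
      · have : permMagic σ a b = 0 := by simp [permMagic, hσ, hb]
        rw [this]
        exact Commute.zero_right _
    · rw [Pi.mulSingle_eq_of_ne ha]
      exact Commute.one_left _
  · rw [map_mul, map_mul, lift_u, lift_u, lift_u]
    simp only [Matrix.of_apply, Pi.mulSingle_eq_of_ne hij, Pi.mulSingle_eq_same]
    intro h
    -- The word maps to `E₀₀ · flip · E₁₁ = E₀₁`, which is nonzero exactly at this entry.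
    have h' := congrFun (congrFun h 0) 1
    simp [permMagic, hσ, h0, h1, flip, Matrix.mul_apply] at h'

/-! ### Central functionals on short words -/

section Central

variable {φ : Pol G N →ₗ[ℂ] ℂ}

theorem sum_smul_u (hφ : IsCentral φ) (i j : Fin N) :
    ∑ p, φ (u G N i p) • u G N p j = ∑ p, φ (u G N p j) • u G N i p := by
  have h := hφ.slice_eq (u G N i j)
  simpa [comul_u] using h

theorem sum_smul_u_mul_u (hφ : IsCentral φ) (i j k l : Fin N) :
    ∑ p, ∑ q, φ (u G N i p * u G N k q) • (u G N p j * u G N q l) =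
      ∑ p, ∑ q, φ (u G N p j * u G N q l) • (u G N i p * u G N k q) := by
  have h := hφ.slice_eq (u G N i j * u G N k l)
  simpa [comul_u, Finset.sum_mul_sum] using h

theorem sum_smul_u_mul_u_mul_u (hφ : IsCentral φ) (i j k l m n : Fin N) :
    ∑ r, ∑ q, ∑ p, φ (u G N i p * u G N k q * u G N m r) •
        (u G N p j * u G N q l * u G N r n) =
      ∑ r, ∑ q, ∑ p, φ (u G N p j * u G N q l * u G N r n) •
        (u G N i p * u G N k q * u G N m r) := by
  have h := hφ.slice_eq (u G N i j * u G N k l * u G N m n)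
  simpa [comul_u, Finset.sum_mul_sum, Finset.sum_mul, Finset.mul_sum] using h

/-- In the free group algebra the slice identity reads `φ(u_ij) g_j = φ(u_ij) g_i`, and distinct
group elements are linearly independent. -/
theorem map_u_of_ne (hφ : IsCentral φ) {i j : Fin N} (hij : i ≠ j) : φ (u G N i j) = 0 := by
  have h := congrArg (lift _ _ (sat_freeGroup G N)) (sum_smul_u hφ i j)
  simp only [map_sum, map_smul, lift_u, Matrix.diagonal_apply, smul_ite, smul_zero,
    Finset.sum_ite_eq, Finset.sum_ite_eq', Finset.mem_univ, if_true] at h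
  by_contra h0
  exact hij (FreeGroup.of_injective
    (MonoidAlgebra.of_injective (smul_right_injective _ h0 h))).symm

/-- A product of two generators without inverses is already a reduced word, so its letters can be
read off. -/
theorem of_mul_of_injective {i j k l : Fin N}
    (h : FreeGroup.of i * FreeGroup.of k = FreeGroup.of j * FreeGroup.of l) : i = j ∧ k = l := by
  have := congrArg FreeGroup.toWord h
  simpa [FreeGroup.of, FreeGroup.toWord_mk, FreeGroup.reduce] using this

theorem map_u_mul_u_of_ne (hφ : IsCentral φ) {i j k l : Fin N} (hne : ¬(i = j ∧ k = l)) :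
    φ (u G N i j * u G N k l) = 0 := by
  have h := congrArg (lift _ _ (sat_freeGroup G N)) (sum_smul_u_mul_u hφ i j k l)
  simp only [map_sum, map_smul, map_mul, lift_u, Matrix.diagonal_apply, smul_ite, smul_zero,
    mul_ite, ite_mul, mul_zero, zero_mul,
    Finset.sum_ite_eq, Finset.sum_ite_eq', Finset.mem_univ, if_true] at h
  by_contra h0
  rw [← map_mul, ← map_mul] at h
  have h' := of_mul_of_injective (MonoidAlgebra.of_injective (smul_right_injective _ h0 h))
  exact hne ⟨h'.1.symm, h'.2.symm⟩

theorem map_u_diag (hφ : IsCentral φ) (i j : Fin N) : φ (u G N i i) = φ (u G N j j) := by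
  have h := sum_smul_u hφ i j
  rw [Finset.sum_eq_single i (fun p _ hp => by rw [map_u_of_ne hφ hp.symm, zero_smul]) (by simp),
    Finset.sum_eq_single j (fun p _ hp => by rw [map_u_of_ne hφ hp, zero_smul]) (by simp)] at h
  exact smul_left_injective ℂ (u_ne_zero i j) h

/-- Once the off-diagonal values are gone, each side of the slice identity is a single multiple of
the same word `u_ij u_kl`, which can be cancelled if it is nonzero. -/
theorem map_u_mul_u_diag (hφ : IsCentral φ) {i j k l : Fin N}
    (hne : u G N i j * u G N k l ≠ 0) :
    φ (u G N i i * u G N k k) = φ (u G N j j * u G N l l) := by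
  have h := sum_smul_u_mul_u hφ i j k l
  simp only [← Finset.sum_product', Finset.univ_product_univ] at h
  rw [Finset.sum_eq_single (i, k)
      (fun p _ hp => by
        rw [map_u_mul_u_of_ne hφ (fun h => hp (Prod.ext h.1.symm h.2.symm)), zero_smul])
      (by simp),
    Finset.sum_eq_single (j, l)
      (fun p _ hp => by
        rw [map_u_mul_u_of_ne hφ (fun h => hp (Prod.ext h.1 h.2)), zero_smul])
      (by simp)] at h
  exact smul_left_injective ℂ hne h

/-- Vanishing on `K 3` expresses the value through words of length one and two; every term contains
either a killed shorter word or the counit of an off-diagonal letter. -/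
theorem map_u_mul_u_mul_u_of_ne (hφ : IsCentral φ) (h1 : φ 1 = 0)
    (h3 : ∀ x ∈ K (Pol G N) 3, φ x = 0) {i j k l m n : Fin N}
    (hne : ¬(i = j ∧ k = l ∧ m = n)) : φ (u G N i j * u G N k l * u G N m n) = 0 := by
  rw [map_mul_mul_of_vanish_three h1 h3]
  simp only [counit_u]
  by_cases hij : i = j <;> by_cases hkl : k = l <;> by_cases hmn : m = n <;>
    simp_all [map_u_of_ne hφ, map_u_mul_u_of_ne hφ]

theorem map_u_mul_u_mul_u_diag (hφ : IsCentral φ) (h1 : φ 1 = 0)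
    (h3 : ∀ x ∈ K (Pol G N) 3, φ x = 0) {i j k l m n : Fin N}
    (hne : u G N i j * u G N k l * u G N m n ≠ 0) :
    φ (u G N i i * u G N k k * u G N m m) = φ (u G N j j * u G N l l * u G N n n) := by
  have h := sum_smul_u_mul_u_mul_u hφ i j k l m n
  simp only [← Finset.sum_product', Finset.univ_product_univ] at h
  -- The sums run over the indices of the third, second and first letter in this order, so the
  -- triples are reversed.
  rw [Finset.sum_eq_single (m, k, i)
      (fun p _ hp => by
        rw [map_u_mul_u_mul_u_of_ne hφ h1 h3
          (fun h => hp (Prod.ext h.2.2.symm (Prod.ext h.2.1.symm h.1.symm))), zero_smul])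
      (by simp),
    Finset.sum_eq_single (n, l, j)
      (fun p _ hp => by
        rw [map_u_mul_u_mul_u_of_ne hφ h1 h3
          (fun h => hp (Prod.ext h.2.2 (Prod.ext h.2.1 h.1))), zero_smul])
      (by simp)] at h
  exact smul_left_injective ℂ hne h

/-- For three indices, words of length three identify the two diagonal values on words of
length two. -/
theorem map_u_mul_self_of_three (hφ : IsCentral φ) (h1 : φ 1 = 0)
    (h3 : ∀ x ∈ K (Pol G N) 3, φ x = 0) (hN : 3 ≤ N) {i j : Fin N} (hij : i ≠ j) :
    φ (u G N i i * u G N i i) = φ (u G N i i * u G N j j) := by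
  obtain ⟨k, hki, hkj⟩ := Fin.exists_ne_and_ne_of_two_lt i j hN
  have h := map_u_mul_u_mul_u_diag hφ h1 h3
    (u_mul_u_mul_u_ne_zero (G := G) hij (Ne.symm hki) (Ne.symm hkj))
  -- The word gives `φ(u_ii u_jj u_ii) = φ(u_ii u_kk u_jj)`. After expansion, the pair `u_ii u_ii`
  -- occurs only on the left, and all other pairs have distinct indices and equal values.
  simp only [map_mul_mul_of_vanish_three h1 h3, counit_u, if_true, mul_one] at h
  have ekj := map_u_mul_u_diag hφ (u_mul_u_ne_zero (G := G) hkj hij)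
  have eik := map_u_mul_u_diag hφ (u_mul_u_ne_zero (G := G) hki.symm hij)
  have eji := map_u_mul_u_diag hφ (u_mul_u_ne_zero (G := G) hij.symm hij)
  have ek := map_u_diag hφ k i
  have ej := map_u_diag hφ j i
  rw [ekj, eik, eji, ek, ej] at h
  linear_combination h

theorem map_u_mul_u_eq (hφ : IsCentral φ)
    (hself : ∀ i j : Fin N, i ≠ j → φ (u G N i i * u G N i i) = φ (u G N i i * u G N j j))
    (o i j k l : Fin N) :
    φ (u G N i j * u G N k l) = if i = j ∧ k = l then φ (u G N o o * u G N o o) else 0 := by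
  split_ifs with h
  · obtain ⟨rfl, rfl⟩ := h
    -- The squares `u_io u_io` are nonzero, so all `φ(u_ii u_ii)` agree; `hself` then reaches the
    -- mixed words.
    have ho : ∀ i, φ (u G N i i * u G N i i) = φ (u G N o o * u G N o o) := fun i =>
      map_u_mul_u_diag hφ (i := i) (j := o) (by
        have h := u_mul_u_ne_zero_of_perm (G := G) (Equiv.swap i o) i i
        rwa [Equiv.swap_apply_left] at h)
    by_cases hik : i = k
    · subst hik
      exact ho i
    · rw [← hself i k hik, ho]
  · exact map_u_mul_u_of_ne hφ h

end Central

/-! ### Gaussian functionals with scalar values on short words -/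

/-- The values `c` and `e` are not independent: positivity and unitarity force `c = iν - μ/2` and `e
= 2iν - 2μ`, the Brownian values at `z` and `z²`. Agreement on words of length one and two then
suffices. -/
theorem exists_eq_brownian {φ : Pol G N →ₗ[ℂ] ℂ} (hφ : IsGaussian φ) (o : Fin N) {c e : ℂ}
    (hc : ∀ i j, φ (u G N i j) = if i = j then c else 0)
    (he : ∀ i j k l, φ (u G N i j * u G N k l) = if i = j ∧ k = l then e else 0) :
    ∃ (ν : ℝ) (μ : ℝ≥0), φ = brownian ν μ ∘ₗ (toCircle G N : Pol G N →ₗ[ℂ] PolT) := by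
  have h1 := hφ.generating.map_one
  have hx : ∀ i j k l, φ (augment G N (u G N i j) * augment G N (u G N k l)) =
      if i = j ∧ k = l then e - 2 * c else 0 := by
    intro i j k l
    simp only [augment_apply, counit_u, sub_mul, mul_sub, smul_mul_assoc, mul_smul_comm, one_mul,
      mul_one, map_sub, map_smul, h1, hc, he, smul_eq_mul]
    by_cases hij : i = j <;> by_cases hkl : k = l <;> simp [hij, hkl]
    ring
  have hyx : ∀ i j k l, φ (augment G N (v G N j i) * augment G N (u G N k l)) =
      - if i = j ∧ k = l then e - 2 * c else 0 := fun i j k l => by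
    rw [map_augment_v_mul hφ.map_K_three i j (counit_augment _), hx]
  have hstar : star (augment G N (u G N o o)) = augment G N (v G N o o) := by
    simp [augment_apply, counit_u, counit_v, star_u]
  -- Conditional positivity at `u_oo - 1`: replacing the adjoint factor by `-(u_oo - 1)` turns the
  -- value into `-(e - 2c)`.
  have hpos : 0 ≤ 2 * c - e := by
    have h := hφ.generating.nonneg _ (counit_augment (u G N o o))
    rw [hstar, hyx] at h
    simpa using h
  have hv : φ (v G N o o) = star c := by
    rw [← star_u, hφ.generating.map_star, hc, if_pos rfl]
  -- Apply `φ` to `∑ₖ u_ok* u_ok = 1`; only `k = o` contributes. Since `e - 2c` is `-μ`, this fixes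
  -- the real part of `c`.
  have hsum : star c + c = e - 2 * c := by
    have h := congrArg φ (congrFun (congrFun (sat G N).1.conj_mul_adj o) o)
    rw [Matrix.mul_apply, map_sum, Matrix.one_apply_eq, h1] at h
    have hk : ∀ k, φ (v G N o k * (u G N).transpose k o) =
        if o = k then star c + c - (e - 2 * c) else 0 := by
      intro k
      rw [Matrix.transpose_apply]
      have h' := hyx k o o k
      simp only [augment_apply, counit_u, counit_v, sub_mul, mul_sub, smul_mul_assoc,
        mul_smul_comm, one_mul, mul_one, map_sub, map_smul, h1, hc, smul_eq_mul] at h'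
      by_cases hok : o = k
      · subst hok
        simp [hv] at h' ⊢
        linear_combination h'
      · simpa [hok, Ne.symm hok] using h'
    simp only [hk, Finset.sum_ite_eq, Finset.mem_univ, if_true] at h
    linear_combination h
  obtain ⟨hre, him⟩ := Complex.nonneg_iff.mp hpos
  let μ : ℝ≥0 := ⟨(2 * c - e).re, hre⟩
  have hμ : (μ : ℂ) = 2 * c - e := Complex.ext rfl him
  have hcc : Complex.I * c.im - μ / 2 = c := by
    have hs : (starRingEnd ℂ) c + c = e - 2 * c := hsum
    rw [hμ]
    have h2 := Complex.re_add_im c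
    have h3 : (starRingEnd ℂ) c = c.re - c.im * Complex.I := by
      apply Complex.ext <;> simp
    linear_combination (-1 / 2 : ℂ) * hs + (1 / 2 : ℂ) * h3 + (1 / 2 : ℂ) * h2
  refine ⟨c.im, μ, ?_⟩
  have hb := (isGaussian_brownian c.im μ).comp (toCircle G N) toCircle_star
  rw [← sub_eq_zero]
  refine eq_zero_of_vanish_three ?_ (fun x hx => ?_) (fun i j => ?_) fun i j k l => ?_
  · rw [LinearMap.sub_apply, h1, hb.generating.map_one, sub_zero]
  · rw [LinearMap.sub_apply, hφ.map_K_three x hx, hb.map_K_three x hx, sub_zero]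
  · change φ _ - brownian _ _ (toCircle G N _) = 0
    rw [hc, toCircle_u]
    split_ifs
    · rw [brownian_T]
      push_cast
      linear_combination -hcc
    · simp
  · change φ _ - brownian _ _ (toCircle G N _) = 0
    rw [he, map_mul, toCircle_u, toCircle_u]
    by_cases hij : i = j <;> by_cases hkl : k = l <;> simp only [hij, hkl, if_true, if_false,
      and_self, and_true, and_false, mul_zero, zero_mul, map_zero, sub_zero]
    rw [← LaurentPolynomial.T_add, brownian_T]
    push_cast
    linear_combination hμ - 2 * hcc

/-- The classification, given that the two diagonal values on words of length two agree. -/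
theorem classification (hN : 2 ≤ N) (φ : Pol G N →ₗ[ℂ] ℂ)
    (hself : IsGaussian φ → IsCentral φ → ∀ i j : Fin N, i ≠ j →
      φ (u G N i i * u G N i i) = φ (u G N i i * u G N j j)) :
    (IsGaussian φ ∧ IsCentral φ ↔
      ∃ ψ : PolT →ₗ[ℂ] ℂ, IsGaussian ψ ∧ φ = ψ ∘ₗ (toCircle G N : Pol G N →ₗ[ℂ] PolT)) ∧
    (IsGaussian φ ∧ IsCentral φ ↔
      ∃! p : ℝ × ℝ≥0, φ = brownian p.1 p.2 ∘ₗ (toCircle G N : Pol G N →ₗ[ℂ] PolT)) := by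
  have hex : IsGaussian φ ∧ IsCentral φ →
      ∃ (ν : ℝ) (μ : ℝ≥0), φ = brownian ν μ ∘ₗ (toCircle G N : Pol G N →ₗ[ℂ] PolT) := by
    rintro ⟨hg, hc⟩
    let o : Fin N := ⟨0, by omega⟩
    refine exists_eq_brownian hg o (c := φ (u G N o o)) (fun i j => ?_)
      (map_u_mul_u_eq hc (hself hg hc) o)
    split_ifs with h
    · subst h
      exact map_u_diag hc i o
    · exact map_u_of_ne hc h
  have hback : ∀ ψ : PolT →ₗ[ℂ] ℂ, IsGaussian ψ →
      φ = ψ ∘ₗ (toCircle G N : Pol G N →ₗ[ℂ] PolT) → IsGaussian φ ∧ IsCentral φ := by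
    rintro ψ hψ rfl
    exact ⟨hψ.comp _ toCircle_star, isCentral_comp_toCircle ψ⟩
  refine ⟨⟨fun h => ?_, fun ⟨ψ, hψ, h⟩ => hback ψ hψ h⟩, ⟨fun h => ?_, fun ⟨p, hp, _⟩ =>
    hback _ (isGaussian_brownian p.1 p.2) hp⟩⟩
  · obtain ⟨ν, μ, h⟩ := hex h
    exact ⟨_, isGaussian_brownian ν μ, h⟩
  · obtain ⟨ν, μ, h⟩ := hex h
    refine ⟨(ν, μ), h, fun q hq => ?_⟩
    have hb : brownian q.1 q.2 = brownian ν μ := by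
      -- Surjectivity onto `Pol(𝕋)` allows `toCircle` to be cancelled, so uniqueness can be checked
      -- on the circle.
      refine LinearMap.ext fun f => ?_
      obtain ⟨a, rfl⟩ := toCircle_surjective (G := G) (by omega : 1 ≤ N) f
      exact congrArg (fun g : Pol G N →ₗ[ℂ] ℂ => g a) (hq.symm.trans h)
    obtain ⟨h1, h2⟩ := brownian_injective hb
    exact Prod.ext h1 h2

end Pol

end QG
end

/-! ### The two families and the Brownian motion -/

theorem mainTheorem6 :
    (∀ (N : ℕ), 2 ≤ N → ∀ φ : QG.PolU N →ₗ[ℂ] ℂ,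
      (QG.IsGaussian φ ∧ QG.IsCentral φ ↔
        ∃ ψ : QG.PolT →ₗ[ℂ] ℂ, QG.IsGaussian ψ ∧
          φ = ψ ∘ₗ (QG.Pol.toCircle .U N : QG.PolU N →ₗ[ℂ] QG.PolT)) ∧
      (QG.IsGaussian φ ∧ QG.IsCentral φ ↔
        ∃! p : ℝ × ℝ≥0,
          φ = QG.brownian p.1 p.2 ∘ₗ (QG.Pol.toCircle .U N : QG.PolU N →ₗ[ℂ] QG.PolT))) ∧
    (∀ (N : ℕ), 3 ≤ N → ∀ φ : QG.PolH N →ₗ[ℂ] ℂ,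
      (QG.IsGaussian φ ∧ QG.IsCentral φ ↔
        ∃ ψ : QG.PolT →ₗ[ℂ] ℂ, QG.IsGaussian ψ ∧
          φ = ψ ∘ₗ (QG.Pol.toCircle .H N : QG.PolH N →ₗ[ℂ] QG.PolT)) ∧
      (QG.IsGaussian φ ∧ QG.IsCentral φ ↔
        ∃! p : ℝ × ℝ≥0,
          φ = QG.brownian p.1 p.2 ∘ₗ (QG.Pol.toCircle .H N : QG.PolH N →ₗ[ℂ] QG.PolT))) ∧
    (∀ (ν : ℝ) (μ t : ℝ≥0) (n : ℤ),
      Complex.exp (t * QG.brownian ν μ (LaurentPolynomial.T n)) =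
        ∫ x : ℝ, Complex.exp (Complex.I * n * x)
          ∂(ProbabilityTheory.gaussianReal (ν * t) (μ * t))) := by
  refine ⟨fun N hN φ => QG.Pol.classification hN φ fun _ hc i j hij => ?_,
    fun N hN φ => QG.Pol.classification (by omega) φ fun hg hc i j hij => ?_,
    QG.exp_brownian_T⟩
  -- For `U` the nonzero word `u_ii u_ij` suffices, and only centrality is used. For `H` this word
  -- is zero by row orthogonality, so the next case passes through length three and needs vanishing
  -- on `K 3`.
  · exact QG.Pol.map_u_mul_u_diag hc (QG.Pol.u_mul_u_ne_zero_of_unitary hij)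
  · exact QG.Pol.map_u_mul_self_of_three hc hg.generating.map_one hg.map_K_three hN hij
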